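/- Let $n\ge 1$, $m\ge 0$ be integers, and write $x=(x_1,x_2)\in\mathbf R^n\times\mathbf R^m$. For $a\ge 0$ put $a^{(\alpha,\alpha')}=a^{\alpha}$ if $a\le 1$ and $a^{(\alpha,\alpha')}=a^{\alpha'}$ if $a\ge 1$. For non-negative $f,g$ write $f\sim g$ if there are constants $a,a'>0$ with $a f\le g\le a' f$ uniformly (almost everywhere, for coefficients, and in the order of symmetric matrices, for matrix-valued functions). Let $\delta_1,\delta_1'\in[0,1)$ and $\delta_2,\delta_2'\ge 0$, let $c_1,c_2$ be measurable functions on $\mathbf R^n$ with $c_i(x_1)\sim|x_1|^{(2\delta_i,2\delta_i')}$, let $C_\delta(x_1,x_2)=c_1(x_1)I_n\oplus c_2(x_1)I_m$, and let $C$ be any measurable real symmetric $(n+m)\times(n+m)$ matrix function on $\mathbf R^n\times\mathbf R^m$ with $C\sim C_\delta$. The Riemannian distance of a coefficient matrix $A=(a_{ij})$ is $$d_A(x;y)=\sup\Big\{\psi(x)-\psi(y):\ \psi\in W^{1,\infty}(\mathbf R^{n+m}),\ \sum_{i,j}a_{ij}\,(\partial_i\psi)(\partial_j\psi)\le 1\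 \text{a.e.}\Big\}\in[0,\infty],$$ where $\psi$ is taken continuous. Its balls are $B_A(x;r)=\{y: d_A(x;y)<r\}$, and $|\cdot|$ of a set is its Lebesgue measure. Set $d_\delta=d_{C_\delta}$, $\rho=1+\delta_2-\delta_1$, $\rho'=1+\delta_2'-\delta_1'$, $\gamma=\delta_2/\rho$, $\gamma'=\delta_2'/\rho'$, $$\Delta_\delta(x;y)=\begin{cases}|x_2-y_2|/(|x_1|+|y_1|)^{(\delta_2,\delta_2')}&\text{if }|x_2-y_2|\le(|x_1|+|y_1|)^{(\rho,\rho')},\\ |x_2-y_2|^{(1-\gamma,1-\gamma')}&\text{if }|x_2-y_2|\ge(|x_1|+|y_1|)^{(\rho,\rho')},\end{cases}$$ $$D_\delta(x;y)=\frac{|x_1-y_1|}{(|x_1|+|y_1|)^{(\delta_1,\delta_1')}}+\Delta_\delta(x;y),$$ with the convention $0/0=0$. Then $d_\delta(x;y)\sim D_\delta(x;y)$, with constants independent of $x,y\in\mathbf R^n\times\mathbf R^m$. Moreover, both for the balls $B=B_{C_\delta}$ of $d_\delta$ and for the balls $B=B_C$ of $d_C$, with constants independent of $x\in\mathbf R^n\times\mathbf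 R^m$ and $r>0$, $$|B(x;r)|\sim\begin{cases}r^{(D,D')}&\text{if }r\ge|x_1|^{(1-\delta_1,1-\delta_1')},\\ r^{n+m}\,|x_1|^{(\beta,\beta')}&\text{if }r\le|x_1|^{(1-\delta_1,1-\delta_1')},\end{cases}$$ where $D=(n+m(1+\delta_2-\delta_1))(1-\delta_1)^{-1}$, $D'=(n+m(1+\delta_2'-\delta_1'))(1-\delta_1')^{-1}$, $\beta=n\delta_1+m\delta_2$ and $\beta'=n\delta_1'+m\delta_2'$. -/

import Mathlib

open MeasureTheory
open scoped ContDiff ENNReal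

noncomputable section

/-- The space `ℝⁿ × ℝᵐ`. Both factors carry the Euclidean norm, and `volume` is Lebesgue measure.
The norm of the product type itself is never used. -/
abbrev GSpace (n m : ℕ) : Type := EuclideanSpace ℝ (Fin n) × EuclideanSpace ℝ (Fin m)

/-- The standard basis of `ℝⁿ × ℝᵐ`, indexed by the `n + m` coordinates. -/
def stdVec (n m : ℕ) : Fin n ⊕ Fin m → GSpace n m
  | Sum.inl i => (EuclideanSpace.single i 1, 0)
  | Sum.inr j => (0, EuclideanSpace.single j 1)

/-- The two-regime power `a^(α, α')` of `a ≥ 0`: `a^α` if `a ≤ 1` and `a^α'` if `a ≥ 1`. -/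
def biPow (a α α' : ℝ) : ℝ := if a ≤ 1 then a ^ α else a ^ α'

/-- `g` is the weak gradient of `ψ` on `ℝⁿ × ℝᵐ`. -/
def IsWeakGradient {n m : ℕ} (ψ : GSpace n m → ℝ) (g : Fin n ⊕ Fin m → GSpace n m → ℝ) : Prop :=
  ∀ φ : GSpace n m → ℝ, ContDiff ℝ ∞ φ → HasCompactSupport φ → ∀ i,
    ∫ x, ψ x * fderiv ℝ φ x (stdVec n m i) = - ∫ x, g i x * φ x

/-- The trial functions for a field `C` of `(n+m) × (n+m)` matrices: the (continuous
representatives of) functions `ψ ∈ W^{1,∞}(ℝⁿ × ℝᵐ)` such that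
`∑ i j, c i j * ∂ i ψ * ∂ j ψ ≤ 1` almost everywhere, the derivatives being weak ones. -/
def IsTrial {n m : ℕ} (C : GSpace n m → Matrix (Fin n ⊕ Fin m) (Fin n ⊕ Fin m) ℝ)
    (ψ : GSpace n m → ℝ) : Prop :=
  Continuous ψ ∧ MemLp ψ ∞ volume ∧
    ∃ g : Fin n ⊕ Fin m → GSpace n m → ℝ,
      (∀ i, MemLp (g i) ∞ volume) ∧ IsWeakGradient ψ g ∧
        ∀ᵐ x, ∑ i, ∑ j, C x i j * g i x * g j x ≤ 1

/-- The Riemannian (quasi-)distance `d(x; y) = sup (ψ x - ψ y) ∈ [0, ∞]` over all trial functions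
`ψ`. Since `ψ = 0` is a trial function, replacing `ψ x - ψ y` by its positive part does not change
the supremum. -/
def riemDist {n m : ℕ} (C : GSpace n m → Matrix (Fin n ⊕ Fin m) (Fin n ⊕ Fin m) ℝ)
    (x y : GSpace n m) : ℝ≥0∞ :=
  ⨆ (ψ : GSpace n m → ℝ) (_ : IsTrial C ψ), ENNReal.ofReal (ψ x - ψ y)

/-- The ball `B(x; r) = {y | d(x; y) < r}` of the Riemannian distance. -/
def riemBall {n m : ℕ} (C : GSpace n m → Matrix (Fin n ⊕ Fin m) (Fin n ⊕ Fin m) ℝ)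
    (x : GSpace n m) (r : ℝ) : Set (GSpace n m) :=
  {y | riemDist C x y < ENNReal.ofReal r}

/-- `c` is a measurable function on `ℝⁿ` with `c(x) ∼ |x|^(2δ, 2δ')`: the quotient of the two is
bounded from above and away from `0`, almost everywhere. -/
def IsDegCoeff {n : ℕ} (δ δ' : ℝ) (c : EuclideanSpace ℝ (Fin n) → ℝ) : Prop :=
  Measurable c ∧ ∃ a a' : ℝ, 0 < a ∧ 0 < a' ∧
    ∀ᵐ x, a * biPow ‖x‖ (2 * δ) (2 * δ') ≤ c x ∧ c x ≤ a' * biPow ‖x‖ (2 * δ) (2 * δ')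

/-- The block diagonal matrix field `C_δ(x₁, x₂) = c₁(x₁) I_n + c₂(x₁) I_m`. -/
def blockCoeff {n m : ℕ} (c₁ c₂ : EuclideanSpace ℝ (Fin n) → ℝ) (x : GSpace n m) :
    Matrix (Fin n ⊕ Fin m) (Fin n ⊕ Fin m) ℝ :=
  Matrix.fromBlocks (c₁ x.1 • 1) 0 0 (c₂ x.1 • 1)

/-- `C ∼ C₀` for fields of real matrices: `a C₀ ≤ C ≤ a' C₀` almost everywhere, in the order of
symmetric matrices, for some `a, a' > 0`. If `C₀` is symmetric and positive definite almost
everywhere then so is `C`. -/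
def CoeffEquiv {n m : ℕ} (C C₀ : GSpace n m → Matrix (Fin n ⊕ Fin m) (Fin n ⊕ Fin m) ℝ) : Prop :=
  ∃ a a' : ℝ, 0 < a ∧ 0 < a' ∧
    ∀ᵐ x, (C x - a • C₀ x).PosSemidef ∧ (a' • C₀ x - C x).PosSemidef

/-- The function `Δ_δ`, with `ρ = 1 + δ₂ - δ₁`, `ρ' = 1 + δ₂' - δ₁'`, `γ = δ₂ / ρ`,
`γ' = δ₂' / ρ'`. The two formulas agree where `|x₂ - y₂| = (|x₁| + |y₁|)^(ρ, ρ')`. -/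
def grushinDelta {n m : ℕ} (δ₁ δ₁' δ₂ δ₂' : ℝ) (x y : GSpace n m) : ℝ :=
  if ‖x.2 - y.2‖ ≤ biPow (‖x.1‖ + ‖y.1‖) (1 + δ₂ - δ₁) (1 + δ₂' - δ₁') then
    ‖x.2 - y.2‖ / biPow (‖x.1‖ + ‖y.1‖) δ₂ δ₂'
  else
    biPow ‖x.2 - y.2‖ (1 - δ₂ / (1 + δ₂ - δ₁)) (1 - δ₂' / (1 + δ₂' - δ₁'))

/-- The function `D_δ = |x₁ - y₁| / (|x₁| + |y₁|)^(δ₁, δ₁') + Δ_δ`. Quotients `0 / 0`, which occur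
only where the numerator vanishes, are `0`. -/
def grushinD {n m : ℕ} (δ₁ δ₁' δ₂ δ₂' : ℝ) (x y : GSpace n m) : ℝ :=
  ‖x.1 - y.1‖ / biPow (‖x.1‖ + ‖y.1‖) δ₁ δ₁' + grushinDelta δ₁ δ₁' δ₂ δ₂' x y

/-- The dimension `(n + m (1 + δ₂ - δ₁)) / (1 - δ₁)`. It is `D` at `(δ₁, δ₂)` and `D'` at
`(δ₁', δ₂')`. -/
def grushinDim (n m : ℕ) (δ₁ δ₂ : ℝ) : ℝ := (n + m * (1 + δ₂ - δ₁)) / (1 - δ₁)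

/-- The two-sided volume estimates for the balls of the Riemannian distance of `C`: for all
centres `x` and all `r > 0`, with constants independent of `x` and `r`,
`|B(x; r)| ∼ r^(D, D')` if `r ≥ |x₁|^(1 - δ₁, 1 - δ₁')`, and
`|B(x; r)| ∼ r^(n+m) |x₁|^(β, β')` if `r ≤ |x₁|^(1 - δ₁, 1 - δ₁')`, where
`β = n δ₁ + m δ₂` and `β' = n δ₁' + m δ₂'`. -/
def BallVolumeEstimates {n m : ℕ} (δ₁ δ₁' δ₂ δ₂' : ℝ)
    (C : GSpace n m → Matrix (Fin n ⊕ Fin m) (Fin n ⊕ Fin m) ℝ) : Prop :=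
  ∃ a a' : ℝ, 0 < a ∧ 0 < a' ∧ ∀ (x : GSpace n m) (r : ℝ), 0 < r →
    (biPow ‖x.1‖ (1 - δ₁) (1 - δ₁') ≤ r →
      ENNReal.ofReal (a * biPow r (grushinDim n m δ₁ δ₂) (grushinDim n m δ₁' δ₂'))
          ≤ volume (riemBall C x r) ∧
      volume (riemBall C x r)
          ≤ ENNReal.ofReal (a' * biPow r (grushinDim n m δ₁ δ₂) (grushinDim n m δ₁' δ₂'))) ∧
    (r ≤ biPow ‖x.1‖ (1 - δ₁) (1 - δ₁') →
      ENNReal.ofReal (a * (r ^ (n + m) * biPow ‖x.1‖ (n * δ₁ + m * δ₂) (n * δ₁' + m * δ₂')))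
          ≤ volume (riemBall C x r) ∧
      volume (riemBall C x r)
          ≤ ENNReal.ofReal
              (a' * (r ^ (n + m) * biPow ‖x.1‖ (n * δ₁ + m * δ₂) (n * δ₁' + m * δ₂'))))

end

/-!
The distance of a coefficient field `C ∼ C_δ` is compared with the explicit function `D_δ`; the
volume estimates then only concern the sublevel sets of `D_δ`.

A trial function has weak derivatives of size `O(|x₁|^(-δ₁))` in the first variable and
`O(|x₁|^(-δ₂))` in the second (`exists_abs_mul_gradWeight_le`), the exponents depending on the
regime `|x₁| ≤ 1` or `|x₁| ≥ 1`. Conversely a bounded Lipschitz function whose derivatives are a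
small multiple of these bounds is a trial function (`exists_isTrial_of_lipschitz`). Nothing else
about `C` enters, so `C` and `C_δ` are treated alike.

*Upper bound.* Mollification turns the almost everywhere bound on the weak gradient into a bound for
increments along segments that stay away from `x₁ = 0` (`IsWeakGradient.sub_le`). Since
`δ₁, δ₁' < 1`, the cost of moving `x₁` to `0` is a convergent geometric series
(`HasLocalBound.abs_sub_zero_le`), and continuity of the trial function allows paths through
`x₁ = 0`, also for `n = 1`. A displacement `u` of the second variable is made at the radius
`S = max (|x₁| + |y₁|) (u^(1/ρ))`, at cost `u / S^δ₂`; this quotient is exactly `Δ_δ`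
(`grushinDelta_eq`).

*Lower bound.* Cones `max (H - A (|z₁ - p₁| - r)₊ - B |z₂ - p₂|) 0` whose support lies in
`|z₁| ≤ 2 T` and whose slopes are adapted to `|z₁| = T` are trial functions
(`exists_isTrial_coneBump`). They are centred at `x` with `T = |x₁|`, except for displacements with
`u^(1/ρ) ≥ |x₁| + |y₁|`, for which the cone has a flat part of radius `T = u^(1/ρ)` around
`z₁ = 0`.

*Volume.* With `M = max |x₁| (r^(1/(1 - δ₁)))`, the ball of radius `r` about `x` lies between two
products of Euclidean balls of radii comparable to `r M^δ₁` and `r M^δ₂`, of volume comparable to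
`r^(n+m) M^β`. This is the stated formula in each of the two cases.
-/

/-! ### Two-regime powers -/

theorem biPow_nonneg {a : ℝ} (ha : 0 ≤ a) (α α' : ℝ) : 0 ≤ biPow a α α' := by
  unfold biPow; split_ifs <;> positivity

theorem biPow_pos {a : ℝ} (ha : 0 < a) (α α' : ℝ) : 0 < biPow a α α' := by
  unfold biPow; split_ifs <;> positivity

theorem biPow_one_one (a : ℝ) : biPow a 1 1 = a := by
  simp [biPow]

theorem biPow_zero_left {α α' : ℝ} (h : α ≠ 0) : biPow 0 α α' = 0 := by
  simp [biPow, Real.zero_rpow h]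

theorem biPow_mul_biPow {a : ℝ} (ha : 0 < a) (α α' β β' : ℝ) :
    biPow a α α' * biPow a β β' = biPow a (α + β) (α' + β') := by
  unfold biPow; split_ifs <;> rw [Real.rpow_add ha]

theorem biPow_div_biPow {a : ℝ} (ha : 0 < a) (α α' β β' : ℝ) :
    biPow a α α' / biPow a β β' = biPow a (α - β) (α' - β') := by
  unfold biPow; split_ifs <;> rw [Real.rpow_sub ha]

theorem biPow_pow {a : ℝ} (ha : 0 ≤ a) (α α' : ℝ) (k : ℕ) :
    biPow a α α' ^ k = biPow a (k * α) (k * α') := by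
  unfold biPow; split_ifs <;> rw [mul_comm, Real.rpow_mul_natCast ha]

theorem biPow_le_one {a α α' : ℝ} (ha : 0 ≤ a) (h1 : a ≤ 1) (hα : 0 ≤ α) :
    biPow a α α' ≤ 1 := by
  rw [biPow, if_pos h1]; exact Real.rpow_le_one ha h1 hα

theorem biPow_biPow {a : ℝ} (ha : 0 ≤ a) {α α' : ℝ} (hα : 0 < α) (hα' : 0 < α') (β β' : ℝ) :
    biPow (biPow a α α') β β' = biPow a (α * β) (α' * β') := by
  by_cases h1 : a ≤ 1
  · have := biPow_le_one (α' := α') ha h1 hα.le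
    rw [biPow, if_pos this, biPow, if_pos h1, biPow, if_pos h1, Real.rpow_mul ha]
  · have h2 : biPow a α α' = a ^ α' := by rw [biPow, if_neg h1]
    have h3 : ¬ a ^ α' ≤ 1 := not_le.2 (Real.one_lt_rpow (not_le.1 h1) hα')
    rw [h2, biPow, if_neg h3, biPow, if_neg h1, Real.rpow_mul ha]

theorem biPow_mono {a b α α' : ℝ} (ha : 0 ≤ a) (hab : a ≤ b) (hα : 0 ≤ α) (hα' : 0 ≤ α') :
    biPow a α α' ≤ biPow b α α' := by
  by_cases hb : b ≤ 1
  · rw [biPow, if_pos (hab.trans hb), biPow, if_pos hb]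
    exact Real.rpow_le_rpow ha hab hα
  · by_cases h1 : a ≤ 1
    · refine (biPow_le_one ha h1 hα).trans ?_
      rw [biPow, if_neg hb]
      exact Real.one_le_rpow (not_le.1 hb).le hα'
    · rw [biPow, if_neg h1, biPow, if_neg hb]
      exact Real.rpow_le_rpow ha hab hα'

/-- Enlarging the base by a factor `k ≥ 1` costs at most the larger of the two powers of `k`, also
across the change of regime. -/
theorem biPow_mul_le_of_one_le {a k α α' : ℝ} (ha : 0 ≤ a) (hk : 1 ≤ k) :
    biPow (k * a) α α' ≤ k ^ max α α' * biPow a α α' := by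
  have hk0 : 0 ≤ k := zero_le_one.trans hk
  have l1 : k ^ α ≤ k ^ max α α' := Real.rpow_le_rpow_of_exponent_le hk (le_max_left _ _)
  have l2 : k ^ α' ≤ k ^ max α α' := Real.rpow_le_rpow_of_exponent_le hk (le_max_right _ _)
  have hka : a ≤ k * a := le_mul_of_one_le_left ha hk
  by_cases h1 : k * a ≤ 1
  · rw [biPow, if_pos h1, biPow, if_pos (hka.trans h1), Real.mul_rpow hk0 ha]
    gcongr
  · rw [biPow, if_neg h1]
    by_cases h2 : a ≤ 1
    · rw [biPow, if_pos h2]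
      have ha0 : 0 < a := by
        rcases ha.eq_or_lt with h | h
        · exfalso; apply h1; rw [← h]; simp
        · exact h
      calc (k * a) ^ α' ≤ (k * a) ^ max α α' :=
            Real.rpow_le_rpow_of_exponent_le (not_le.1 h1).le (le_max_right _ _)
        _ = k ^ max α α' * a ^ max α α' := Real.mul_rpow hk0 ha
        _ ≤ k ^ max α α' * a ^ α :=
            mul_le_mul_of_nonneg_left
              (Real.rpow_le_rpow_of_exponent_ge ha0 h2 (le_max_left _ _)) (by positivity)
    · rw [biPow, if_neg h2, Real.mul_rpow hk0 ha]
      gcongr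

/-- Shrinking the base by a factor `k ≤ 1` gains at least the smaller of the two powers, also across
the change of regime. -/
theorem biPow_mul_le_of_le_one {a k α α' : ℝ} (ha : 0 < a) (hk0 : 0 < k) (hk : k ≤ 1) :
    biPow (k * a) α α' ≤ k ^ min α α' * biPow a α α' := by
  have l1 : k ^ α ≤ k ^ min α α' := Real.rpow_le_rpow_of_exponent_ge hk0 hk (min_le_left _ _)
  have l2 : k ^ α' ≤ k ^ min α α' := Real.rpow_le_rpow_of_exponent_ge hk0 hk (min_le_right _ _)
  have hka : k * a ≤ a := mul_le_of_le_one_left ha.le hk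
  by_cases h1 : k * a ≤ 1
  · rw [biPow, if_pos h1]
    by_cases h2 : a ≤ 1
    · rw [biPow, if_pos h2, Real.mul_rpow hk0.le ha.le]
      gcongr
    · rw [biPow, if_neg h2]
      calc (k * a) ^ α ≤ (k * a) ^ min α α' :=
            Real.rpow_le_rpow_of_exponent_ge (by positivity) h1 (min_le_left _ _)
        _ = k ^ min α α' * a ^ min α α' := Real.mul_rpow hk0.le ha.le
        _ ≤ k ^ min α α' * a ^ α' :=
            mul_le_mul_of_nonneg_left
              (Real.rpow_le_rpow_of_exponent_le (not_le.1 h2).le (min_le_right _ _))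
              (by positivity)
  · have h2 : ¬ a ≤ 1 := fun h => h1 (hka.trans h)
    rw [biPow, if_neg h1, biPow, if_neg h2, Real.mul_rpow hk0.le ha.le]
    gcongr

theorem biPow_inv_biPow {a α α' : ℝ} (ha : 0 ≤ a) (hα : 0 < α) (hα' : 0 < α') :
    biPow (biPow a α α') (1 / α) (1 / α') = a := by
  rw [biPow_biPow ha hα hα', mul_one_div_cancel hα.ne', mul_one_div_cancel hα'.ne', biPow_one_one]

theorem biPow_biPow_inv {a α α' : ℝ} (ha : 0 ≤ a) (hα : 0 < α) (hα' : 0 < α') :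
    biPow (biPow a (1 / α) (1 / α')) α α' = a := by
  rw [biPow_biPow ha (by positivity) (by positivity), one_div_mul_cancel hα.ne',
    one_div_mul_cancel hα'.ne', biPow_one_one]

theorem biPow_le_iff {a b α α' : ℝ} (ha : 0 ≤ a) (hb : 0 ≤ b) (hα : 0 < α) (hα' : 0 < α') :
    biPow a α α' ≤ b ↔ a ≤ biPow b (1 / α) (1 / α') := by
  constructor
  · intro h
    rw [← biPow_inv_biPow ha hα hα']
    exact biPow_mono (biPow_nonneg ha _ _) h (by positivity) (by positivity)
  · intro h
    rw [← biPow_biPow_inv hb hα hα']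
    exact biPow_mono ha h hα.le hα'.le

theorem le_biPow_iff {a b α α' : ℝ} (ha : 0 ≤ a) (hb : 0 ≤ b) (hα : 0 < α) (hα' : 0 < α') :
    b ≤ biPow a α α' ↔ biPow b (1 / α) (1 / α') ≤ a := by
  rw [biPow_le_iff hb ha (by positivity) (by positivity), one_div_one_div, one_div_one_div]

/-- A bound for a two-regime power up to a constant is a bound for its base up to a constant. -/
theorem le_mul_of_biPow_le {a b K α α' : ℝ} (ha : 0 ≤ a) (hb : 0 ≤ b) (hK : 1 ≤ K) (hα : 0 < α)
    (hα' : 0 < α') (h : biPow a α α' ≤ K * biPow b α α') :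
    a ≤ K ^ max (1 / α) (1 / α') * b := by
  have hb' := biPow_nonneg hb α α'
  rw [biPow_le_iff ha (by positivity) hα hα'] at h
  refine h.trans ((biPow_mul_le_of_one_le hb' hK).trans ?_)
  rw [biPow_inv_biPow hb hα hα']

theorem div_biPow_eq {T : ℝ} (hT : 0 < T) (α α' : ℝ) :
    T / biPow T α α' = biPow T (1 - α) (1 - α') := by
  rw [← biPow_div_biPow hT, biPow_one_one]

/-- A displacement `u` made at its own scale `R` costs `R^(1 - δ₁, 1 - δ₁')`. -/
theorem div_biPow_biPow_inv {u δ₁ δ₁' δ₂ δ₂' : ℝ} (hu : 0 < u) (hρ : 0 < 1 + δ₂ - δ₁)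
    (hρ' : 0 < 1 + δ₂' - δ₁') :
    u / biPow (biPow u (1 / (1 + δ₂ - δ₁)) (1 / (1 + δ₂' - δ₁'))) δ₂ δ₂' =
      biPow (biPow u (1 / (1 + δ₂ - δ₁)) (1 / (1 + δ₂' - δ₁'))) (1 - δ₁) (1 - δ₁') := by
  set R := biPow u (1 / (1 + δ₂ - δ₁)) (1 / (1 + δ₂' - δ₁')) with hR
  have hR0 : 0 < R := biPow_pos hu _ _
  have h : u = biPow R (1 + δ₂ - δ₁) (1 + δ₂' - δ₁') := by
    rw [hR, biPow_biPow_inv hu.le hρ hρ']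
  calc u / biPow R δ₂ δ₂' = biPow R (1 + δ₂ - δ₁) (1 + δ₂' - δ₁') / biPow R δ₂ δ₂' := by rw [← h]
    _ = biPow R (1 - δ₁) (1 - δ₁') := by
      rw [biPow_div_biPow hR0]
      congr 1 <;> ring

/-! ### The function `D_δ` -/

/-- The length scale `S` at which a displacement of size `|x₂ - y₂|` is made: `|x₁| + |y₁|`, or
`|x₂ - y₂|^(1/ρ, 1/ρ')` if that is larger. -/
noncomputable def grushinScale (ρ ρ' s u : ℝ) : ℝ := max s (biPow u (1 / ρ) (1 / ρ'))

/-- Both formulas for `Δ_δ` say `|x₂ - y₂| / S^(δ₂, δ₂')`, with `S` the scale `grushinScale`. -/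
theorem grushinDelta_eq {n m : ℕ} {δ₁ δ₁' δ₂ δ₂' : ℝ} (hρ : 0 < 1 + δ₂ - δ₁)
    (hρ' : 0 < 1 + δ₂' - δ₁') (x y : GSpace n m) :
    grushinDelta δ₁ δ₁' δ₂ δ₂' x y = ‖x.2 - y.2‖ /
      biPow (grushinScale (1 + δ₂ - δ₁) (1 + δ₂' - δ₁') (‖x.1‖ + ‖y.1‖) ‖x.2 - y.2‖) δ₂ δ₂' := by
  have hs : 0 ≤ ‖x.1‖ + ‖y.1‖ := by positivity
  have hu : 0 ≤ ‖x.2 - y.2‖ := norm_nonneg _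
  unfold grushinDelta grushinScale
  split_ifs with h
  · rw [max_eq_left ((le_biPow_iff hs hu hρ hρ').1 h)]
  · rw [le_biPow_iff hs hu hρ hρ', not_le] at h
    have hu0 : 0 < ‖x.2 - y.2‖ := by
      rcases hu.eq_or_lt with h0 | h0
      · rw [← h0, biPow_zero_left (by positivity)] at h; linarith
      · exact h0
    rw [max_eq_right h.le, biPow_biPow hu (by positivity) (by positivity)]
    nth_rw 2 [← biPow_one_one ‖x.2 - y.2‖]
    rw [biPow_div_biPow hu0]
    congr 2 <;> ring

theorem grushinScale_pos {ρ ρ' s u : ℝ} (h : 0 < s ∨ 0 < u) :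
    0 < grushinScale ρ ρ' s u := by
  unfold grushinScale
  rcases h with h | h
  · exact lt_max_of_lt_left h
  · exact lt_max_of_lt_right (biPow_pos h _ _)

theorem grushinD_comm {n m : ℕ} {δ₁ δ₁' δ₂ δ₂' : ℝ} (x y : GSpace n m) :
    grushinD δ₁ δ₁' δ₂ δ₂' x y = grushinD δ₁ δ₁' δ₂ δ₂' y x := by
  unfold grushinD grushinDelta
  rw [norm_sub_rev x.1, norm_sub_rev x.2, add_comm ‖x.1‖]

/-! ### Trial functions and weighted gradient bounds -/

instance instIsAddHaarMeasureGSpace (n m : ℕ) :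
    Measure.IsAddHaarMeasure (volume : Measure (GSpace n m)) :=
  inferInstanceAs (Measure.IsAddHaarMeasure (volume.prod volume))

/-- The size `|x₁|^(δ₁, δ₁')` resp. `|x₁|^(δ₂, δ₂')` of the square root of the coefficient of the
`i`-th derivative, as a function of `t = |x₁|`. -/
noncomputable def gradWeight {n m : ℕ} (δ₁ δ₁' δ₂ δ₂' t : ℝ) : Fin n ⊕ Fin m → ℝ :=
  Sum.elim (fun _ => biPow t δ₁ δ₁') (fun _ => biPow t δ₂ δ₂')

theorem blockCoeff_quadratic {n m : ℕ} (c₁ c₂ : EuclideanSpace ℝ (Fin n) → ℝ) (z : GSpace n m)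
    (g : Fin n ⊕ Fin m → ℝ) :
    ∑ i, ∑ j, blockCoeff c₁ c₂ z i j * g i * g j =
      ∑ i, c₁ z.1 * g (Sum.inl i) ^ 2 + ∑ j, c₂ z.1 * g (Sum.inr j) ^ 2 := by
  simp [blockCoeff, Fintype.sum_sum_type, Matrix.one_apply, pow_two, mul_assoc]

theorem Matrix.PosSemidef.sum_mul_le {ι : Type*} [Fintype ι] {A B : Matrix ι ι ℝ} {a b : ℝ}
    (h : (a • A - b • B).PosSemidef) (g : ι → ℝ) :
    b * ∑ i, ∑ j, B i j * g i * g j ≤ a * ∑ i, ∑ j, A i j * g i * g j := by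
  have := h.dotProduct_mulVec_nonneg g
  simp only [dotProduct, Matrix.mulVec, Matrix.sub_apply, Matrix.smul_apply, smul_eq_mul,
    Pi.star_apply, star_trivial] at this
  rw [← sub_nonneg]
  refine this.trans_eq ?_
  simp only [Finset.mul_sum, ← Finset.sum_sub_distrib]
  refine Finset.sum_congr rfl fun i _ => Finset.sum_congr rfl fun j _ => ?_
  ring

section CoeffBounds

variable {n m : ℕ} {δ₁ δ₁' δ₂ δ₂' : ℝ} {c₁ c₂ : EuclideanSpace ℝ (Fin n) → ℝ}
  {C : GSpace n m → Matrix (Fin n ⊕ Fin m) (Fin n ⊕ Fin m) ℝ}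

theorem IsDegCoeff.ae_prod {δ δ' : ℝ} {c : EuclideanSpace ℝ (Fin n) → ℝ} (h : IsDegCoeff δ δ' c) :
    ∃ a a' : ℝ, 0 < a ∧ 0 < a' ∧ ∀ᵐ z : GSpace n m,
      a * biPow ‖z.1‖ δ δ' ^ 2 ≤ c z.1 ∧ c z.1 ≤ a' * biPow ‖z.1‖ δ δ' ^ 2 := by
  obtain ⟨-, a, a', ha, ha', h⟩ := h
  refine ⟨a, a', ha, ha', ?_⟩
  have := (Measure.quasiMeasurePreserving_fst (μ := (volume : Measure (EuclideanSpace ℝ (Fin n))))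
    (ν := (volume : Measure (EuclideanSpace ℝ (Fin m))))).ae h
  filter_upwards [this] with z hz
  rwa [biPow_pow (norm_nonneg _)]

/-- The constraint on the gradient of a trial function bounds each partial derivative. -/
theorem exists_abs_mul_gradWeight_le (hc₁ : IsDegCoeff δ₁ δ₁' c₁) (hc₂ : IsDegCoeff δ₂ δ₂' c₂)
    (hC : CoeffEquiv C (blockCoeff c₁ c₂)) :
    ∃ K : ℝ, 0 < K ∧ ∀ᵐ z, ∀ g : Fin n ⊕ Fin m → ℝ, ∑ i, ∑ j, C z i j * g i * g j ≤ 1 →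
      ∀ i, |g i| * gradWeight δ₁ δ₁' δ₂ δ₂' ‖z.1‖ i ≤ K := by
  obtain ⟨a₁, _, h₁, _, H₁⟩ := hc₁.ae_prod (m := m)
  obtain ⟨a₂, _, h₂, _, H₂⟩ := hc₂.ae_prod (m := m)
  obtain ⟨a, _, h, _, H⟩ := hC
  have aux : ∀ b p c q : ℝ, 0 < b → b ≤ a * c → 0 ≤ q → c * p ^ 2 * q ^ 2 ≤ 1 / a →
      0 ≤ p → p * q ≤ 1 + 1 / b := by
    intro b p c q hb hbc hq hle hp
    have h1 : b * (p * q) ^ 2 ≤ 1 := by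
      calc b * (p * q) ^ 2 ≤ a * c * (p * q) ^ 2 := by gcongr
        _ = a * (c * p ^ 2 * q ^ 2) := by ring
        _ ≤ a * (1 / a) := by gcongr
        _ = 1 := by field_simp
    have h2 : (p * q) ^ 2 ≤ 1 / b := by rw [le_div_iff₀ hb]; linarith
    nlinarith [sq_nonneg (p * q - 1)]
  refine ⟨1 + 1 / (a * min a₁ a₂), by positivity, ?_⟩
  filter_upwards [H₁, H₂, H] with z hz₁ hz₂ hz g hg i
  have hq := Matrix.PosSemidef.sum_mul_le (a := 1) (by simpa using hz.1) g
  rw [one_mul, blockCoeff_quadratic] at hq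
  have hq' := (le_div_iff₀' h).2 (hq.trans hg)
  have hn₁ : ∀ i, 0 ≤ c₁ z.1 * g (Sum.inl i) ^ 2 := fun i =>
    mul_nonneg (le_trans (by positivity) hz₁.1) (sq_nonneg _)
  have hn₂ : ∀ i, 0 ≤ c₂ z.1 * g (Sum.inr i) ^ 2 := fun i =>
    mul_nonneg (le_trans (by positivity) hz₂.1) (sq_nonneg _)
  rcases i with i | i
  · refine aux _ _ a₁ _ (by positivity) (by gcongr; exact min_le_left _ _)
      (biPow_nonneg (norm_nonneg _) _ _) ?_ (abs_nonneg _)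
    have e1 := Finset.single_le_sum (fun i _ => hn₁ i) (Finset.mem_univ i)
    have e2 := Finset.sum_nonneg (fun i (_ : i ∈ Finset.univ) => hn₂ i)
    have e3 := mul_le_mul_of_nonneg_right hz₁.1 (sq_nonneg (g (Sum.inl i)))
    change a₁ * |g (Sum.inl i)| ^ 2 * biPow ‖z.1‖ δ₁ δ₁' ^ 2 ≤ _
    rw [sq_abs]; linarith
  · refine aux _ _ a₂ _ (by positivity) (by gcongr; exact min_le_right _ _)
      (biPow_nonneg (norm_nonneg _) _ _) ?_ (abs_nonneg _)
    have e1 := Finset.single_le_sum (fun i _ => hn₂ i) (Finset.mem_univ i)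
    have e2 := Finset.sum_nonneg (fun i (_ : i ∈ Finset.univ) => hn₁ i)
    have e3 := mul_le_mul_of_nonneg_right hz₂.1 (sq_nonneg (g (Sum.inr i)))
    change a₂ * |g (Sum.inr i)| ^ 2 * biPow ‖z.1‖ δ₂ δ₂' ^ 2 ≤ _
    rw [sq_abs]; linarith

/-- Small weighted partial derivatives imply the constraint on the gradient of a trial function. -/
theorem exists_quadratic_le_one (hc₁ : IsDegCoeff δ₁ δ₁' c₁) (hc₂ : IsDegCoeff δ₂ δ₂' c₂)
    (hC : CoeffEquiv C (blockCoeff c₁ c₂)) :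
    ∃ κ : ℝ, 0 < κ ∧ ∀ᵐ z, ∀ g : Fin n ⊕ Fin m → ℝ,
      (∀ i, |g i| * gradWeight δ₁ δ₁' δ₂ δ₂' ‖z.1‖ i ≤ κ) →
        ∑ i, ∑ j, C z i j * g i * g j ≤ 1 := by
  obtain ⟨_, a₁, _, h₁, H₁⟩ := hc₁.ae_prod (m := m)
  obtain ⟨_, a₂, _, h₂, H₂⟩ := hc₂.ae_prod (m := m)
  obtain ⟨_, a, _, h, H⟩ := hC
  set N : ℝ := a * (n * a₁ + m * a₂) with hN
  have hN0 : 0 ≤ N := by positivity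
  have hκ : N * (1 / (1 + N)) ^ 2 ≤ 1 := by
    rw [div_pow, one_pow, mul_one_div, div_le_one (by positivity)]; nlinarith
  set κ : ℝ := 1 / (1 + N)
  have hκ0 : 0 < κ := by positivity
  have aux : ∀ b c p g : ℝ, 0 < b → 0 ≤ p → c ≤ b * p ^ 2 → |g| * p ≤ κ →
      c * g ^ 2 ≤ b * κ ^ 2 := by
    intro b c p g hb hp hc hg
    calc c * g ^ 2 ≤ b * p ^ 2 * g ^ 2 := by gcongr
      _ = b * (|g| * p) ^ 2 := by rw [mul_pow, sq_abs]; ring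
      _ ≤ b * κ ^ 2 := by gcongr
  refine ⟨κ, hκ0, ?_⟩
  filter_upwards [H₁, H₂, H] with z hz₁ hz₂ hz g hg
  have hq := Matrix.PosSemidef.sum_mul_le (b := 1) (by simpa using hz.2) g
  rw [one_mul, blockCoeff_quadratic] at hq
  refine hq.trans (le_trans ?_ hκ)
  rw [hN, mul_assoc]
  refine mul_le_mul_of_nonneg_left ?_ h.le
  have hp := fun α α' => biPow_nonneg (norm_nonneg z.1) α α'
  have e1 : ∑ i, c₁ z.1 * g (Sum.inl i) ^ 2 ≤ ∑ _i : Fin n, a₁ * κ ^ 2 :=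
    Finset.sum_le_sum fun i _ => aux _ _ _ _ h₁ (hp _ _) hz₁.2 (hg (Sum.inl i))
  have e2 : ∑ i, c₂ z.1 * g (Sum.inr i) ^ 2 ≤ ∑ _i : Fin m, a₂ * κ ^ 2 :=
    Finset.sum_le_sum fun i _ => aux _ _ _ _ h₂ (hp _ _) hz₂.2 (hg (Sum.inr i))
  simp only [Finset.sum_const, Finset.card_univ, Fintype.card_fin, nsmul_eq_mul] at e1 e2
  linarith

end CoeffBounds

theorem isWeakGradient_lineDeriv {n m : ℕ} {ψ : GSpace n m → ℝ} {K : NNReal}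
    (hψ : LipschitzWith K ψ) : IsWeakGradient ψ fun i z => lineDeriv ℝ ψ z (stdVec n m i) := by
  intro φ hφ hc i
  obtain ⟨D, hD⟩ := hφ.lipschitzWith_of_hasCompactSupport hc (by simp)
  have := hψ.integral_lineDeriv_mul_eq (μ := volume) hD hc (stdVec n m i)
  rw [this, ← integral_neg]
  refine integral_congr_ae (Filter.Eventually.of_forall fun z => ?_)
  have hd : DifferentiableAt ℝ φ z := (hφ.differentiable (by simp)).differentiableAt
  simp only [hd.lineDeriv_eq_fderiv, map_neg]
  ring

/-- Bounded Lipschitz functions with small weighted partial derivatives are trial functions. -/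
theorem exists_isTrial_of_lipschitz {n m : ℕ} {δ₁ δ₁' δ₂ δ₂' : ℝ}
    {c₁ c₂ : EuclideanSpace ℝ (Fin n) → ℝ}
    {C : GSpace n m → Matrix (Fin n ⊕ Fin m) (Fin n ⊕ Fin m) ℝ}
    (hc₁ : IsDegCoeff δ₁ δ₁' c₁) (hc₂ : IsDegCoeff δ₂ δ₂' c₂)
    (hC : CoeffEquiv C (blockCoeff c₁ c₂)) :
    ∃ κ : ℝ, 0 < κ ∧ ∀ (ψ : GSpace n m → ℝ) (K : NNReal) (M : ℝ), LipschitzWith K ψ →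
      (∀ z, |ψ z| ≤ M) →
      (∀ z i, |lineDeriv ℝ ψ z (stdVec n m i)| * gradWeight δ₁ δ₁' δ₂ δ₂' ‖z.1‖ i ≤ κ) →
      IsTrial C ψ := by
  obtain ⟨κ, hκ, H⟩ := exists_quadratic_le_one hc₁ hc₂ hC
  refine ⟨κ, hκ, fun ψ K M hψ hM hd => ⟨hψ.continuous, ?_, _, fun i => hψ.memLp_lineDeriv _,
    isWeakGradient_lineDeriv hψ, ?_⟩⟩
  · exact memLp_top_of_bound hψ.continuous.aestronglyMeasurable M (Filter.Eventually.of_forall hM)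
  · filter_upwards [H] with z hz
    exact hz _ (hd z)

/-! ### Increments of a function with bounded weak gradient -/

section Segment
open Convolution

/-- A continuous function whose weak derivative in the direction `v = ∑ i, w i • e i` is at most `L`
on a convex open set increases by at most `L` from `x` to `x + v` in that set. The proof mollifies,
and so uses no pointwise differentiability. -/
theorem IsWeakGradient.sub_le {n m : ℕ} {ψ : GSpace n m → ℝ} {g : Fin n ⊕ Fin m → GSpace n m → ℝ}
    (hψ : Continuous ψ) (hgm : ∀ i, MemLp (g i) ∞ volume) (hg : IsWeakGradient ψ g)
    {U : Set (GSpace n m)} (hU : IsOpen U) (hconv : Convex ℝ U) {x v : GSpace n m}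
    {w : Fin n ⊕ Fin m → ℝ} (hv : v = ∑ i, w i • stdVec n m i) (hx : x ∈ U) (hxv : x + v ∈ U)
    {L : ℝ} (hL : ∀ᵐ z, z ∈ U → ∑ i, w i * g i z ≤ L) : ψ (x + v) - ψ x ≤ L := by
  obtain ⟨ε, hε, hεU⟩ := (show IsCompact (segment ℝ x (x + v)) by
      rw [segment_eq_image']
      exact isCompact_Icc.image (by fun_prop)).exists_thickening_subset_open hU
    (hconv.segment_subset hx hxv)
  let φ : ℕ → ContDiffBump (0 : GSpace n m) := fun k =>
    ⟨ε / (k + 1) / 2, ε / (k + 1), by positivity, half_lt_self (by positivity)⟩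
  have hr : Filter.Tendsto (fun k => (φ k).rOut) Filter.atTop (nhds 0) :=
    tendsto_const_div_atTop_nhds_zero_nat ε |>.comp (Filter.tendsto_add_atTop_nat 1) |>.congr
      fun k => by simp [φ]
  have : (volume : Measure (GSpace n m)).IsNegInvariant :=
    Measure.IsAddHaarMeasure.isNegInvariant_of_regular _
  have hlim := fun p => ContDiffBump.convolution_tendsto_right_of_continuous
    (μ := (volume : Measure (GSpace n m))) hr hψ p
  refine le_of_tendsto ((hlim (x + v)).sub (hlim x)) (Filter.Eventually.of_forall fun k => ?_)
  set N : GSpace n m → ℝ := (φ k).normed volume with hNdef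
  have hNs : ContDiff ℝ ∞ N := (φ k).contDiff_normed
  have hNc : HasCompactSupport N := (φ k).hasCompactSupport_normed
  have hNpos : ∀ z, 0 ≤ N z := (φ k).nonneg_normed
  have hrk : (φ k).rOut ≤ ε := div_le_self hε.le (by simp)
  -- the convolution is differentiable because its smooth factor is
  set Λ : ℝ →L[ℝ] ℝ →L[ℝ] ℝ := (ContinuousLinearMap.lsmul ℝ ℝ).flip with hΛ
  have hflip : N ⋆[ContinuousLinearMap.lsmul ℝ ℝ, volume] ψ = ψ ⋆[Λ, volume] N := by
    rw [hΛ, convolution_flip]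
  rw [hflip]
  have hF := fun p => hNc.hasFDerivAt_convolution_right Λ hψ.locallyIntegrable
    (hNs.of_le (by simp)) p (μ := (volume : Measure (GSpace n m)))
  -- the derivative of the mollified function averages the weak derivative
  have hder : ∀ p ∈ segment ℝ x (x + v),
      (ψ ⋆[Λ.precompR (GSpace n m), volume] fderiv ℝ N) p v ≤ L := by
    intro p hp
    rw [convolution_precompR_apply _ hψ.locallyIntegrable (hNc.fderiv ℝ)
      (hNs.continuous_fderiv (by simp))]
    set φp : GSpace n m → ℝ := fun t => N (p - t) with hφp
    have hs : ContDiff ℝ ∞ φp := hNs.comp (contDiff_const.sub contDiff_id)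
    have hcs : HasCompactSupport φp := hNc.comp_homeomorph (Homeomorph.subLeft p)
    have hfd : ∀ t e, fderiv ℝ φp t e = - fderiv ℝ N (p - t) e := by
      intro t e
      have h1 : HasFDerivAt (fun t : GSpace n m => p - t) (-ContinuousLinearMap.id ℝ _) t :=
        (hasFDerivAt_id t).const_sub p
      have h2 := ((hNs.differentiable (by simp)) (p - t)).hasFDerivAt.comp t h1
      rw [show φp = N ∘ (fun t => p - t) from rfl, h2.fderiv]
      simp
    have hint1 : ∀ i, Integrable (fun t => ψ t * fderiv ℝ φp t (stdVec n m i)) := fun i =>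
      (hψ.mul ((hs.continuous_fderiv (by simp)).clm_apply continuous_const))
        |>.integrable_of_hasCompactSupport (HasCompactSupport.mul_left
          ((hcs.fderiv_apply ℝ _)))
    have hφint : Integrable φp := hs.continuous.integrable_of_hasCompactSupport hcs
    have hint2 : ∀ i, Integrable (fun t => g i t * φp t) := fun i =>
      hφint.mul_of_top_right (hgm i)
    have hone : ∫ t, φp t = 1 := by
      rw [hφp, integral_sub_left_eq_self N volume p]
      exact (φ k).integral_normed
    calc (ψ ⋆[Λ, volume] fun a => fderiv ℝ N a v) p
        = -∫ t, ∑ i, w i * (ψ t * fderiv ℝ φp t (stdVec n m i)) := by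
          rw [convolution_def, ← integral_neg]
          congr 1; ext t
          simp only [hfd, hΛ, hv, map_sum, map_smul, smul_eq_mul,
            ContinuousLinearMap.flip_apply, ContinuousLinearMap.lsmul_apply, ← Finset.sum_neg_distrib]
          refine Finset.sum_congr rfl fun i _ => ?_
          ring
      _ = -∑ i, w i * ∫ t, ψ t * fderiv ℝ φp t (stdVec n m i) := by
          rw [integral_finsetSum _ fun i _ => (hint1 i).const_mul (w i)]
          simp only [integral_const_mul]
      _ = ∑ i, w i * ∫ t, g i t * φp t := by
          rw [← Finset.sum_neg_distrib]
          refine Finset.sum_congr rfl fun i _ => ?_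
          rw [hg φp hs hcs i]; ring
      _ = ∫ t, (∑ i, w i * g i t) * φp t := by
          simp only [← integral_const_mul]
          rw [← integral_finsetSum _ fun i _ => (hint2 i).const_mul (w i)]
          simp only [Finset.sum_mul, mul_assoc]
      _ ≤ ∫ t, L * φp t := by
          refine integral_mono_ae ?_ (hφint.const_mul L) ?_
          · simp only [Finset.sum_mul, mul_assoc]
            exact integrable_finsetSum _ fun i _ => (hint2 i).const_mul (w i)
          · filter_upwards [hL] with t ht
            by_cases htU : t ∈ U
            · exact mul_le_mul_of_nonneg_right (ht htU) (hNpos _)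
            · have : φp t = 0 := by
                by_contra h0
                refine htU (hεU ?_)
                have : p - t ∈ Function.support N := h0
                rw [hNdef, (φ k).support_normed_eq, Metric.mem_ball, dist_zero_right] at this
                rw [Metric.mem_thickening_iff]
                exact ⟨p, hp, by rw [dist_comm, dist_eq_norm]; exact this.trans_le hrk⟩
              simp [this]
      _ = L := by rw [integral_const_mul, hone, mul_one]
  have hline : ∀ t : ℝ, HasDerivAt (fun s : ℝ => (ψ ⋆[Λ, volume] N) (x + s • v))
      ((ψ ⋆[Λ.precompR (GSpace n m), volume] fderiv ℝ N) (x + t • v) v) t := by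
    intro t
    have h1 : HasDerivAt (fun s : ℝ => x + s • v) v t := by
      simpa using ((hasDerivAt_id t).smul_const v).const_add x
    exact (hF (x + t • v)).comp_hasDerivAt t h1
  have := (convex_Icc (0 : ℝ) 1).image_sub_le_mul_sub_of_deriv_le
    (f := fun s : ℝ => (ψ ⋆[Λ, volume] N) (x + s • v)) (C := L)
    (fun t _ => (hline t).continuousAt.continuousWithinAt)
    (fun t _ => (hline t).differentiableAt.differentiableWithinAt)
    (fun t ht => by
      rw [(hline t).deriv]
      refine hder _ ?_
      rw [segment_eq_image']
      exact ⟨t, interior_subset ht, by simp⟩)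
    0 (by simp) 1 (by simp) zero_le_one
  simpa using this

end Segment

/-! ### The upper bound for the distance -/

section UpperBound

variable {n m : ℕ} {δ₁ δ₁' δ₂ δ₂' : ℝ}

theorem eq_sum_smul_stdVec (v : GSpace n m) :
    v = ∑ i, (Sum.elim (fun i => v.1 i) (fun j => v.2 j) i : ℝ) • stdVec n m i := by
  have key : ∀ (k : ℕ) (a : EuclideanSpace ℝ (Fin k)),
      a = ∑ i, a i • EuclideanSpace.single i (1 : ℝ) := by
    intro k a
    ext j
    simp [Pi.single_apply]
  rw [Fintype.sum_sum_type]
  ext1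
  · simpa [Prod.fst_sum, stdVec] using key n v.1
  · simpa [Prod.snd_sum, stdVec] using key m v.2

/-- `ψ` is continuous and, up to the constant `c`, its increments at scale at most `|x₁| / 2` are
those allowed by the gradient bounds at `x₁`. -/
def HasLocalBound (δ₁ δ₁' δ₂ δ₂' c : ℝ) (ψ : GSpace n m → ℝ) : Prop :=
  Continuous ψ ∧ ∀ x v : GSpace n m, x.1 ≠ 0 → ‖v.1‖ ≤ ‖x.1‖ / 2 →
    |ψ (x + v) - ψ x| ≤ c * (‖v.1‖ / biPow ‖x.1‖ δ₁ δ₁' + ‖v.2‖ / biPow ‖x.1‖ δ₂ δ₂')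

theorem exists_hasLocalBound {c₁ c₂ : EuclideanSpace ℝ (Fin n) → ℝ}
    {C : GSpace n m → Matrix (Fin n ⊕ Fin m) (Fin n ⊕ Fin m) ℝ}
    (hδ₁ : 0 ≤ δ₁) (hδ₁' : 0 ≤ δ₁') (hδ₂ : 0 ≤ δ₂) (hδ₂' : 0 ≤ δ₂')
    (hc₁ : IsDegCoeff δ₁ δ₁' c₁) (hc₂ : IsDegCoeff δ₂ δ₂' c₂)
    (hC : CoeffEquiv C (blockCoeff c₁ c₂)) :
    ∃ c : ℝ, 0 < c ∧ ∀ ψ : GSpace n m → ℝ, IsTrial C ψ → HasLocalBound δ₁ δ₁' δ₂ δ₂' c ψ := by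
  obtain ⟨K, hK, H⟩ := exists_abs_mul_gradWeight_le hc₁ hc₂ hC
  set A : ℝ := (4 : ℝ) ^ max δ₁ δ₁' with hA
  set B : ℝ := (4 : ℝ) ^ max δ₂ δ₂' with hB
  have hA0 : 0 < A := by positivity
  have hB0 : 0 < B := by positivity
  refine ⟨n * (K * A) + m * (K * B) + 1, by positivity, ?_⟩
  rintro ψ ⟨hψ, -, g, hgm, hg, hle⟩
  refine ⟨hψ, fun x v hx hv => ?_⟩
  have ht : 0 < ‖x.1‖ := norm_pos_iff.2 hx
  set t := ‖x.1‖ with ht_def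
  have hp₁ := biPow_pos ht δ₁ δ₁'
  have hp₂ := biPow_pos ht δ₂ δ₂'
  -- on this set `|z₁| ≥ |x₁| / 4`, and the endpoints of the segment lie in it
  set U : Set (GSpace n m) := Prod.fst ⁻¹' Metric.ball x.1 (3 / 4 * t) with hUdef
  have hU : IsOpen U := Metric.isOpen_ball.preimage continuous_fst
  have hconv : Convex ℝ U := (convex_ball _ _).linear_preimage (LinearMap.fst ℝ _ _)
  have hxU : x ∈ U := Metric.mem_ball_self (by positivity)
  have hxvU : x + v ∈ U := by
    change dist (x + v).1 x.1 < 3 / 4 * t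
    rw [dist_eq_norm]; simp only [Prod.fst_add, add_sub_cancel_left]; linarith
  have hgi : ∀ᵐ z, z ∈ U → (∀ i, |g (Sum.inl i) z| ≤ K * A / biPow t δ₁ δ₁') ∧
      ∀ j, |g (Sum.inr j) z| ≤ K * B / biPow t δ₂ δ₂' := by
    filter_upwards [H, hle] with z hz hzg hzU
    have hz' := hz (fun i => g i z) hzg
    have h4 : t ≤ 4 * ‖z.1‖ := by
      have h1 : ‖z.1 - x.1‖ < 3 / 4 * t := by rw [← dist_eq_norm]; exact hzU
      have h2 := norm_sub_norm_le x.1 z.1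
      rw [norm_sub_rev] at h2
      linarith
    have aux : ∀ α α' a : ℝ, 0 ≤ α → 0 ≤ α' → |a| * biPow ‖z.1‖ α α' ≤ K →
        |a| ≤ K * (4 : ℝ) ^ max α α' / biPow t α α' := by
      intro α α' a hα hα' ha
      rw [le_div_iff₀ (biPow_pos ht _ _)]
      calc |a| * biPow t α α' ≤ |a| * biPow (4 * ‖z.1‖) α α' := by
            gcongr; exact biPow_mono ht.le h4 hα hα'
        _ ≤ |a| * ((4 : ℝ) ^ max α α' * biPow ‖z.1‖ α α') := by
            gcongr; exact biPow_mul_le_of_one_le (norm_nonneg _) (by norm_num)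
        _ = |a| * biPow ‖z.1‖ α α' * (4 : ℝ) ^ max α α' := by ring
        _ ≤ K * (4 : ℝ) ^ max α α' := by gcongr
    exact ⟨fun i => aux _ _ _ hδ₁ hδ₁' (hz' (Sum.inl i)),
      fun j => aux _ _ _ hδ₂ hδ₂' (hz' (Sum.inr j))⟩
  set L : ℝ := n * (‖v.1‖ * (K * A / biPow t δ₁ δ₁')) + m * (‖v.2‖ * (K * B / biPow t δ₂ δ₂'))
    with hLdef
  set w : Fin n ⊕ Fin m → ℝ := Sum.elim (fun i => v.1 i) (fun j => v.2 j) with hw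
  have habs : ∀ᵐ z, z ∈ U → |∑ i, w i * g i z| ≤ L := by
    filter_upwards [hgi] with z hz hzU
    obtain ⟨h1, h2⟩ := hz hzU
    rw [Fintype.sum_sum_type]
    refine (abs_add_le _ _).trans (add_le_add ?_ ?_)
    · refine (Finset.abs_sum_le_sum_abs _ _).trans ((Finset.sum_le_card_nsmul _ _
        (‖v.1‖ * (K * A / biPow t δ₁ δ₁')) fun i _ => ?_).trans_eq (by simp))
      rw [abs_mul]
      exact mul_le_mul (PiLp.norm_apply_le v.1 i) (h1 i) (abs_nonneg _) (norm_nonneg _)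
    · refine (Finset.abs_sum_le_sum_abs _ _).trans ((Finset.sum_le_card_nsmul _ _
        (‖v.2‖ * (K * B / biPow t δ₂ δ₂')) fun i _ => ?_).trans_eq (by simp))
      rw [abs_mul]
      exact mul_le_mul (PiLp.norm_apply_le v.2 i) (h2 i) (abs_nonneg _) (norm_nonneg _)
  have hup : ψ (x + v) - ψ x ≤ L := by
    refine hg.sub_le hψ hgm hU hconv (eq_sum_smul_stdVec v) hxU hxvU ?_
    filter_upwards [habs] with z hz hzU using (le_abs_self _).trans (hz hzU)
  have hdown : ψ (x + v + -v) - ψ (x + v) ≤ L := by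
    refine hg.sub_le hψ hgm hU hconv (w := fun i => -w i) ?_ hxvU (by simpa using hxU) ?_
    · simp only [neg_smul, Finset.sum_neg_distrib]
      rw [hw, ← eq_sum_smul_stdVec v]
    · filter_upwards [habs] with z hz hzU
      simp only [neg_mul, Finset.sum_neg_distrib]
      exact (neg_le_abs _).trans (hz hzU)
  rw [add_neg_cancel_right] at hdown
  refine (abs_le.2 ⟨by linarith, hup⟩).trans ?_
  set p := ‖v.1‖ / biPow t δ₁ δ₁' with hp
  set q := ‖v.2‖ / biPow t δ₂ δ₂' with hq
  have hp0 : 0 ≤ p := by positivity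
  have hq0 : 0 ≤ q := by positivity
  have hLe : L = n * (K * A) * p + m * (K * B) * q := by rw [hLdef, hp, hq]; ring
  rw [hLe]
  have k1 : 0 ≤ n * (K * A) * q := by positivity
  have k2 : 0 ≤ m * (K * B) * p := by positivity
  linarith

namespace HasLocalBound

variable {c : ℝ} {ψ : GSpace n m → ℝ}

/-- Moving `x₁` radially to `0` costs `O(|x₁|^(1 - δ₁, 1 - δ₁'))`: the increments between `x₁ / 2^k`
and `x₁ / 2^(k+1)` are dominated by a telescoping series. -/
theorem abs_sub_zero_le (hψ : HasLocalBound δ₁ δ₁' δ₂ δ₂' c ψ) (hc : 0 < c)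
    (hδ₁ : δ₁ < 1) (hδ₁' : δ₁' < 1) (a : EuclideanSpace ℝ (Fin n)) (b : EuclideanSpace ℝ (Fin m)) :
    |ψ (a, b) - ψ (0, b)| ≤
      c / (1 - (1 / 2 : ℝ) ^ min (1 - δ₁) (1 - δ₁')) * biPow ‖a‖ (1 - δ₁) (1 - δ₁') := by
  set q : ℝ := (1 / 2 : ℝ) ^ min (1 - δ₁) (1 - δ₁') with hq
  have hq1 : q < 1 := Real.rpow_lt_one (by norm_num) (by norm_num)
    (lt_min (by linarith) (by linarith))
  have hq1' : 0 < 1 - q := by linarith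
  rcases eq_or_ne a 0 with rfl | ha
  · simp only [sub_self, abs_zero]
    exact mul_nonneg (by positivity) (biPow_nonneg (norm_nonneg _) _ _)
  have ht : 0 < ‖a‖ := norm_pos_iff.2 ha
  set h : ℕ → ℝ := fun k => biPow ((1 / 2 : ℝ) ^ k * ‖a‖) (1 - δ₁) (1 - δ₁') with hh
  have hstep : ∀ k : ℕ, |ψ ((1 / 2 : ℝ) ^ (k + 1) • a, b) - ψ ((1 / 2 : ℝ) ^ k • a, b)| ≤
      c / (1 - q) * (h k - h (k + 1)) := by
    intro k
    have hk : 0 < (1 / 2 : ℝ) ^ k := by positivity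
    have hn : ‖(1 / 2 : ℝ) ^ k • a‖ = (1 / 2 : ℝ) ^ k * ‖a‖ := by
      rw [norm_smul, Real.norm_of_nonneg hk.le]
    have hn' : ‖-(1 / 2 : ℝ) ^ (k + 1) • a‖ = (1 / 2 : ℝ) ^ k * ‖a‖ / 2 := by
      rw [norm_smul, norm_neg, Real.norm_of_nonneg (by positivity), pow_succ]; ring
    have := hψ.2 ((1 / 2 : ℝ) ^ k • a, b) (-(1 / 2 : ℝ) ^ (k + 1) • a, 0)
      (smul_ne_zero hk.ne' ha) (by simp only [hn, hn']; exact le_rfl)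
    have e : (((1 / 2 : ℝ) ^ k • a, b) : GSpace n m) + (-(1 / 2 : ℝ) ^ (k + 1) • a, 0) =
        ((1 / 2 : ℝ) ^ (k + 1) • a, b) := by
      ext1
      · simp only [Prod.fst_add, ← add_smul]; congr 1; rw [pow_succ]; ring
      · simp
    rw [e] at this
    simp only [hn, hn', norm_zero, zero_div, add_zero] at this
    refine this.trans ?_
    have hpos : 0 < (1 / 2 : ℝ) ^ k * ‖a‖ := by positivity
    have e2 : (1 / 2 : ℝ) ^ k * ‖a‖ / 2 / biPow ((1 / 2 : ℝ) ^ k * ‖a‖) δ₁ δ₁' = h k / 2 := by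
      simp only [hh]
      rw [← biPow_div_biPow hpos, biPow_one_one]; ring
    have e3 : h (k + 1) ≤ q * h k := by
      simp only [hh]
      rw [pow_succ', mul_assoc]
      exact biPow_mul_le_of_le_one hpos (by norm_num) (by norm_num)
    have hk0 : 0 ≤ h k := biPow_nonneg hpos.le _ _
    rw [e2]
    calc c * (h k / 2) ≤ c * h k := by gcongr; linarith
      _ = c / (1 - q) * (h k - q * h k) := by field_simp
      _ ≤ c / (1 - q) * (h k - h (k + 1)) := by gcongr
  have hsum : ∀ k : ℕ, |ψ ((1 / 2 : ℝ) ^ k • a, b) - ψ (a, b)| ≤ c / (1 - q) * (h 0 - h k) := by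
    intro k
    induction k with
    | zero => simp
    | succ k ih =>
      refine (abs_sub_le _ (ψ ((1 / 2 : ℝ) ^ k • a, b)) _).trans ?_
      have := add_le_add (hstep k) ih
      linarith
  have hlim : Filter.Tendsto (fun k : ℕ => |ψ ((1 / 2 : ℝ) ^ k • a, b) - ψ (a, b)|) Filter.atTop
      (nhds |ψ (0, b) - ψ (a, b)|) := by
    have h1 : Filter.Tendsto (fun k : ℕ => ((1 / 2 : ℝ) ^ k • a, b)) Filter.atTop
        (nhds (0, b)) := by
      refine Filter.Tendsto.prodMk_nhds ?_ tendsto_const_nhds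
      simpa using (tendsto_pow_atTop_nhds_zero_of_lt_one (r := (1 / 2 : ℝ)) (by norm_num)
        (by norm_num)).smul_const a
    exact (((hψ.1.tendsto _).comp h1).sub_const _).abs
  rw [abs_sub_comm]
  refine le_of_tendsto hlim (Filter.Eventually.of_forall fun k => (hsum k).trans ?_)
  have h0 : h 0 = biPow ‖a‖ (1 - δ₁) (1 - δ₁') := by simp [hh]
  have hk0 : 0 ≤ h k := biPow_nonneg (by positivity) _ _
  rw [h0]
  gcongr
  linarith

/-- The cost of a displacement of `x₁` alone. If it exceeds `|x₁| / 2` then the path through `0` is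
as good as any. -/
theorem exists_abs_sub_fst_le (hc : 0 < c) (hδ₁ : 0 ≤ δ₁ ∧ δ₁ < 1) (hδ₁' : 0 ≤ δ₁' ∧ δ₁' < 1) :
    ∃ k : ℝ, 0 < k ∧ ∀ ψ : GSpace n m → ℝ, HasLocalBound δ₁ δ₁' δ₂ δ₂' c ψ → ∀ a a' b,
      |ψ (a, b) - ψ (a', b)| ≤ k * (‖a - a'‖ / biPow (‖a‖ + ‖a'‖) δ₁ δ₁') := by
  set q : ℝ := (1 / 2 : ℝ) ^ min (1 - δ₁) (1 - δ₁') with hq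
  have hq1 : q < 1 := Real.rpow_lt_one (by norm_num) (by norm_num)
    (lt_min (by linarith) (by linarith))
  have hq1' : 0 < 1 - q := by linarith
  set k₀ : ℝ := c / (1 - q) with hk₀
  have hk₀0 : 0 < k₀ := by positivity
  set A : ℝ := (2 : ℝ) ^ max δ₁ δ₁' with hA
  have hA0 : 0 < A := by positivity
  refine ⟨(c + 4 * k₀) * A, by positivity, fun ψ hψ a a' b => ?_⟩
  wlog haa : ‖a'‖ ≤ ‖a‖ generalizing a a'
  · rw [abs_sub_comm, norm_sub_rev, add_comm ‖a‖]
    exact this a' a (not_le.1 haa).le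
  rcases eq_or_ne a 0 with rfl | ha
  · have : a' = 0 := by simpa using haa
    simp [this]
  have ht : 0 < ‖a‖ := norm_pos_iff.2 ha
  have hs : 0 < ‖a‖ + ‖a'‖ := by positivity
  have hpt := biPow_pos ht δ₁ δ₁'
  have hps := biPow_pos hs δ₁ δ₁'
  -- `|a|` and `|a| + |a'|` are comparable
  have hcmp : ‖a - a'‖ / biPow ‖a‖ δ₁ δ₁' ≤ A * (‖a - a'‖ / biPow (‖a‖ + ‖a'‖) δ₁ δ₁') := by
    have h1 : biPow (‖a‖ + ‖a'‖) δ₁ δ₁' ≤ A * biPow ‖a‖ δ₁ δ₁' :=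
      (biPow_mono hs.le (by linarith : ‖a‖ + ‖a'‖ ≤ 2 * ‖a‖) hδ₁.1 hδ₁'.1).trans
        (biPow_mul_le_of_one_le ht.le (by norm_num))
    rw [← mul_div_assoc, div_le_div_iff₀ hpt hps]
    calc ‖a - a'‖ * biPow (‖a‖ + ‖a'‖) δ₁ δ₁' ≤ ‖a - a'‖ * (A * biPow ‖a‖ δ₁ δ₁') := by gcongr
      _ = _ := by ring
  have hmain : |ψ (a, b) - ψ (a', b)| ≤ (c + 4 * k₀) * (‖a - a'‖ / biPow ‖a‖ δ₁ δ₁') := by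
    have hd0 : 0 ≤ ‖a - a'‖ / biPow ‖a‖ δ₁ δ₁' := by positivity
    by_cases hd : ‖a - a'‖ ≤ ‖a‖ / 2
    · have := hψ.2 (a, b) (a' - a, 0) ha (by rw [norm_sub_rev] at hd; exact hd)
      have e : ((a, b) : GSpace n m) + (a' - a, 0) = (a', b) := by ext1 <;> simp
      rw [e, norm_sub_rev] at this
      simp only [norm_zero, zero_div, add_zero] at this
      rw [abs_sub_comm]
      nlinarith
    · have h1 := hψ.abs_sub_zero_le hc hδ₁.2 hδ₁'.2 a b
      have h2 := hψ.abs_sub_zero_le hc hδ₁.2 hδ₁'.2 a' b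
      have h3 : biPow ‖a'‖ (1 - δ₁) (1 - δ₁') ≤ biPow ‖a‖ (1 - δ₁) (1 - δ₁') :=
        biPow_mono (norm_nonneg _) haa (by linarith) (by linarith)
      have h4 : biPow ‖a‖ (1 - δ₁) (1 - δ₁') = ‖a‖ / biPow ‖a‖ δ₁ δ₁' := by
        rw [← biPow_div_biPow ht, biPow_one_one]
      have h5 : ‖a‖ / biPow ‖a‖ δ₁ δ₁' ≤ 2 * (‖a - a'‖ / biPow ‖a‖ δ₁ δ₁') := by
        rw [← mul_div_assoc]; gcongr; linarith
      have h6 := abs_sub_le (ψ (a, b)) (ψ (0, b)) (ψ (a', b))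
      rw [abs_sub_comm (ψ (0, b))] at h6
      rw [← hq, ← hk₀] at h1 h2
      have h7 := mul_le_mul_of_nonneg_left (h3.trans (h4.trans_le h5)) hk₀0.le
      have h8 := mul_le_mul_of_nonneg_left (h4.trans_le h5) hk₀0.le
      nlinarith
  refine hmain.trans ?_
  rw [mul_assoc]
  exact mul_le_mul_of_nonneg_left hcmp (by positivity)

/-- A displacement of `x₂` is made either at the given `x₁`, or after moving `x₁` out to the radius
`R` with `R^(ρ, ρ') = |x₂ - y₂|`, whichever of the two radii is larger. -/
theorem exists_abs_sub_le (hn : 1 ≤ n) (hc : 0 < c) (hδ₁ : 0 ≤ δ₁ ∧ δ₁ < 1)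
    (hδ₁' : 0 ≤ δ₁' ∧ δ₁' < 1) (hδ₂ : 0 ≤ δ₂) (hδ₂' : 0 ≤ δ₂') :
    ∃ k : ℝ, 0 < k ∧ ∀ ψ : GSpace n m → ℝ, HasLocalBound δ₁ δ₁' δ₂ δ₂' c ψ → ∀ x y,
      |ψ x - ψ y| ≤ k * grushinD δ₁ δ₁' δ₂ δ₂' x y := by
  obtain ⟨k₁, hk₁, H₁⟩ := exists_abs_sub_fst_le (n := n) (m := m) (δ₂ := δ₂) (δ₂' := δ₂') hc hδ₁ hδ₁'
  set q : ℝ := (1 / 2 : ℝ) ^ min (1 - δ₁) (1 - δ₁') with hq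
  have hq1 : q < 1 := Real.rpow_lt_one (by norm_num) (by norm_num)
    (lt_min (by linarith) (by linarith))
  have hq1' : 0 < 1 - q := by linarith
  set k₀ : ℝ := c / (1 - q) with hk₀
  have hk₀0 : 0 < k₀ := by positivity
  set B : ℝ := (2 : ℝ) ^ max δ₂ δ₂' with hB
  have hB0 : 0 < B := by positivity
  refine ⟨k₁ + c * B + (c + 4 * k₀), by positivity, fun ψ hψ x y => ?_⟩
  wlog hxy : ‖y.1‖ ≤ ‖x.1‖ generalizing x y
  · rw [abs_sub_comm, grushinD_comm]
    exact this y x (not_le.1 hxy).le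
  obtain ⟨a, b⟩ := x
  obtain ⟨a', b'⟩ := y
  rw [grushinD, grushinDelta_eq (by linarith) (by linarith)]
  dsimp only at hxy ⊢
  set E₁ := ‖a - a'‖ / biPow (‖a‖ + ‖a'‖) δ₁ δ₁' with hE₁
  have hs0 : 0 ≤ ‖a‖ + ‖a'‖ := by positivity
  have hE₁0 : 0 ≤ E₁ := div_nonneg (norm_nonneg _) (biPow_nonneg hs0 _ _)
  rcases eq_or_ne b b' with rfl | hb
  · simp only [sub_self, norm_zero, zero_div, add_zero]
    refine (H₁ ψ hψ a a' b).trans ?_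
    gcongr
    have : 0 ≤ c * B + (c + 4 * k₀) := by positivity
    linarith
  have hu : 0 < ‖b - b'‖ := norm_pos_iff.2 (sub_ne_zero.2 hb)
  set u := ‖b - b'‖ with hu_def
  set R := biPow u (1 / (1 + δ₂ - δ₁)) (1 / (1 + δ₂' - δ₁')) with hR
  have hR0 : 0 < R := biPow_pos hu _ _
  -- a pure displacement of `x₂`
  have hmove : ∀ z : EuclideanSpace ℝ (Fin n), z ≠ 0 →
      |ψ (z, b) - ψ (z, b')| ≤ c * (u / biPow ‖z‖ δ₂ δ₂') := by
    intro z hz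
    have := hψ.2 (z, b) (0, b' - b) hz (by simp; positivity)
    have e : ((z, b) : GSpace n m) + (0, b' - b) = (z, b') := by ext1 <;> simp
    rw [e, abs_sub_comm] at this
    simpa [norm_sub_rev b' b] using this
  unfold grushinScale
  rw [← hR]
  rcases le_total R (‖a‖ + ‖a'‖) with hRs | hRs
  · rw [max_eq_left hRs]
    have ht : 0 < ‖a‖ := by linarith
    have hs : 0 < ‖a‖ + ‖a'‖ := by positivity
    set E₂ := u / biPow (‖a‖ + ‖a'‖) δ₂ δ₂' with hE₂
    have hpt := biPow_pos ht δ₂ δ₂'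
    have hps := biPow_pos hs δ₂ δ₂'
    have hE₂0 : 0 ≤ E₂ := by positivity
    have hcmp : u / biPow ‖a‖ δ₂ δ₂' ≤ B * E₂ := by
      have h1 : biPow (‖a‖ + ‖a'‖) δ₂ δ₂' ≤ B * biPow ‖a‖ δ₂ δ₂' :=
        (biPow_mono hs.le (by linarith : ‖a‖ + ‖a'‖ ≤ 2 * ‖a‖) hδ₂ hδ₂').trans
          (biPow_mul_le_of_one_le ht.le (by norm_num))
      rw [hE₂, ← mul_div_assoc, div_le_div_iff₀ hpt hps]
      calc u * biPow (‖a‖ + ‖a'‖) δ₂ δ₂' ≤ u * (B * biPow ‖a‖ δ₂ δ₂') := by gcongr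
        _ = _ := by ring
    have h1 := hmove a (norm_pos_iff.1 ht)
    have h2 := H₁ ψ hψ a a' b'
    have h3 := abs_sub_le (ψ (a, b)) (ψ (a, b')) (ψ (a', b'))
    have h4 := mul_le_mul_of_nonneg_left hcmp hc.le
    have h5 : 0 ≤ (c * B + (c + 4 * k₀)) * E₁ := by positivity
    have h6 : 0 ≤ (k₁ + (c + 4 * k₀)) * E₂ := by positivity
    linarith
  · rw [max_eq_right hRs]
    set E₂ := u / biPow R δ₂ δ₂' with hE₂
    have hE₂0 : 0 ≤ E₂ := div_nonneg hu.le (biPow_nonneg hR0.le _ _)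
    -- the cost of moving out to the radius `R` equals that of the displacement there
    have hRE : biPow R (1 - δ₁) (1 - δ₁') = E₂ :=
      (div_biPow_biPow_inv hu (by linarith) (by linarith)).symm
    have hle : ∀ r : ℝ, 0 ≤ r → r ≤ R → k₀ * biPow r (1 - δ₁) (1 - δ₁') ≤ k₀ * E₂ := by
      intro r hr hrR
      rw [← hRE]
      gcongr
      exact biPow_mono hr hrR (by linarith) (by linarith)
    have hpos := norm_nonneg a
    have hpos' := norm_nonneg a'
    set z : EuclideanSpace ℝ (Fin n) := EuclideanSpace.single ⟨0, hn⟩ R with hz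
    have hzn : ‖z‖ = R := by rw [hz, PiLp.norm_single, Real.norm_of_nonneg hR0.le]
    have hout : ∀ (p : EuclideanSpace ℝ (Fin n)) (w : EuclideanSpace ℝ (Fin m)), ‖p‖ ≤ R →
        |ψ (p, w) - ψ (0, w)| ≤ k₀ * E₂ := fun p w hp =>
      (hψ.abs_sub_zero_le hc hδ₁.2 hδ₁'.2 p w).trans (hle _ (norm_nonneg _) hp)
    have h1 := hout a b (by linarith)
    have h2 := hout z b hzn.le
    have h3 := hout z b' hzn.le
    have h4 := hout a' b' (by linarith)
    have h5 := hmove z (norm_pos_iff.1 (hzn ▸ hR0))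
    rw [hzn] at h5
    have h6 : 0 ≤ (k₁ + c * B + (c + 4 * k₀)) * E₁ := by positivity
    have h7 : 0 ≤ (k₁ + c * B) * E₂ := by positivity
    rw [abs_le] at h1 h2 h3 h4 h5 ⊢
    constructor <;> linarith

end HasLocalBound

theorem exists_riemDist_le {c₁ c₂ : EuclideanSpace ℝ (Fin n) → ℝ}
    {C : GSpace n m → Matrix (Fin n ⊕ Fin m) (Fin n ⊕ Fin m) ℝ} (hn : 1 ≤ n)
    (hδ₁ : 0 ≤ δ₁ ∧ δ₁ < 1) (hδ₁' : 0 ≤ δ₁' ∧ δ₁' < 1) (hδ₂ : 0 ≤ δ₂) (hδ₂' : 0 ≤ δ₂')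
    (hc₁ : IsDegCoeff δ₁ δ₁' c₁) (hc₂ : IsDegCoeff δ₂ δ₂' c₂)
    (hC : CoeffEquiv C (blockCoeff c₁ c₂)) :
    ∃ a' : ℝ, 0 < a' ∧ ∀ x y : GSpace n m,
      riemDist C x y ≤ ENNReal.ofReal (a' * grushinD δ₁ δ₁' δ₂ δ₂' x y) := by
  obtain ⟨c, hc, H⟩ := exists_hasLocalBound hδ₁.1 hδ₁'.1 hδ₂ hδ₂' hc₁ hc₂ hC
  obtain ⟨k, hk, H'⟩ := HasLocalBound.exists_abs_sub_le hn hc hδ₁ hδ₁' hδ₂ hδ₂' (m := m)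
  refine ⟨k, hk, fun x y => iSup₂_le fun ψ hψ => ENNReal.ofReal_le_ofReal ?_⟩
  exact (le_abs_self _).trans (H' ψ (H ψ hψ) x y)

end UpperBound

/-! ### The lower bound for the distance -/

section LowerBound

variable {n m : ℕ} {δ₁ δ₁' δ₂ δ₂' : ℝ}

theorem IsTrial.neg {C : GSpace n m → Matrix (Fin n ⊕ Fin m) (Fin n ⊕ Fin m) ℝ}
    {ψ : GSpace n m → ℝ} (h : IsTrial C ψ) : IsTrial C (-ψ) := by
  obtain ⟨h1, h2, g, hgm, hg, hle⟩ := h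
  refine ⟨h1.neg, h2.neg, fun i => -g i, fun i => (hgm i).neg, fun φ hφ hc i => ?_, ?_⟩
  · simp only [Pi.neg_apply, neg_mul, integral_neg, hg φ hφ hc i]
  · simpa using hle

theorem riemDist_comm (C : GSpace n m → Matrix (Fin n ⊕ Fin m) (Fin n ⊕ Fin m) ℝ)
    (x y : GSpace n m) : riemDist C x y = riemDist C y x := by
  have : ∀ x y, riemDist C x y ≤ riemDist C y x := fun x y => iSup₂_le fun ψ hψ => by
    refine le_trans ?_ (le_iSup₂ (f := fun (ψ : GSpace n m → ℝ) (_ : IsTrial C ψ) =>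
      ENNReal.ofReal (ψ y - ψ x)) (-ψ) hψ.neg)
    simp [add_comm, sub_eq_add_neg]
  exact le_antisymm (this x y) (this y x)

/-- A conical bump around `ball p₁ r × {p₂}` of height `H`, with slope `A` in the first variable
and `B` in the second. -/
noncomputable def coneBump (p : GSpace n m) (r A B H : ℝ) (z : GSpace n m) : ℝ :=
  max (H - A * max (‖z.1 - p.1‖ - r) 0 - B * ‖z.2 - p.2‖) 0

theorem abs_coneBump_sub_le (p : GSpace n m) (r H : ℝ) {A B : ℝ} (hA : 0 ≤ A) (hB : 0 ≤ B)
    (z z' : GSpace n m) :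
    |coneBump p r A B H z - coneBump p r A B H z'| ≤ A * ‖z.1 - z'.1‖ + B * ‖z.2 - z'.2‖ := by
  refine (abs_max_sub_max_le_abs _ _ _).trans ?_
  have h1 : |max (‖z'.1 - p.1‖ - r) 0 - max (‖z.1 - p.1‖ - r) 0| ≤ ‖z.1 - z'.1‖ := by
    refine (abs_max_sub_max_le_abs _ _ _).trans ?_
    have := abs_norm_sub_norm_le (z'.1 - p.1) (z.1 - p.1)
    rw [sub_sub_sub_cancel_right, norm_sub_rev z'.1 z.1] at this
    simpa using this
  have h2 : |‖z'.2 - p.2‖ - ‖z.2 - p.2‖| ≤ ‖z.2 - z'.2‖ := by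
    have := abs_norm_sub_norm_le (z'.2 - p.2) (z.2 - p.2)
    rwa [sub_sub_sub_cancel_right, norm_sub_rev z'.2 z.2] at this
  rw [show H - A * max (‖z.1 - p.1‖ - r) 0 - B * ‖z.2 - p.2‖ -
      (H - A * max (‖z'.1 - p.1‖ - r) 0 - B * ‖z'.2 - p.2‖) =
      A * (max (‖z'.1 - p.1‖ - r) 0 - max (‖z.1 - p.1‖ - r) 0) +
      B * (‖z'.2 - p.2‖ - ‖z.2 - p.2‖) by ring]
  refine (abs_add_le _ _).trans (add_le_add ?_ ?_)
  · rw [abs_mul, abs_of_nonneg hA]; gcongr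
  · rw [abs_mul, abs_of_nonneg hB]; gcongr

theorem lipschitzWith_coneBump (p : GSpace n m) (r H : ℝ) {A B : ℝ} (hA : 0 ≤ A) (hB : 0 ≤ B) :
    LipschitzWith (A + B).toNNReal (coneBump p r A B H) := by
  refine LipschitzWith.of_dist_le_mul fun z z' => ?_
  rw [Real.dist_eq, Real.coe_toNNReal _ (by positivity), dist_eq_norm, add_mul]
  refine (abs_coneBump_sub_le p r H hA hB z z').trans ?_
  gcongr
  · exact norm_fst_le (z - z')
  · exact norm_snd_le (z - z')

theorem abs_lineDeriv_coneBump_le (p : GSpace n m) (r H : ℝ) {A B : ℝ} (hA : 0 ≤ A) (hB : 0 ≤ B)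
    (z : GSpace n m) (i : Fin n ⊕ Fin m) :
    |lineDeriv ℝ (coneBump p r A B H) z (stdVec n m i)| ≤ Sum.elim (fun _ => A) (fun _ => B) i := by
  have key : ∀ K : ℝ, 0 ≤ K → (∀ s t : ℝ, A * ‖(s - t) • (stdVec n m i).1‖ +
      B * ‖(s - t) • (stdVec n m i).2‖ ≤ K * |s - t|) →
      |lineDeriv ℝ (coneBump p r A B H) z (stdVec n m i)| ≤ K := by
    intro K hK h
    have hL : LipschitzWith K.toNNReal
        (fun t : ℝ => coneBump p r A B H (z + t • stdVec n m i)) := by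
      refine LipschitzWith.of_dist_le_mul fun s t => ?_
      rw [Real.dist_eq, Real.coe_toNNReal _ hK, Real.dist_eq]
      refine (abs_coneBump_sub_le p r H hA hB _ _).trans (le_trans (le_of_eq ?_) (h s t))
      simp [sub_smul]
    have := norm_deriv_le_of_lipschitz (x₀ := 0) hL
    rwa [Real.coe_toNNReal _ hK] at this
  rcases i with i | i
  · refine key A hA fun s t => ?_
    simp [stdVec, norm_smul]
  · refine key B hB fun s t => ?_
    simp [stdVec, norm_smul]

theorem lineDeriv_coneBump_eq_zero (p : GSpace n m) (r A B H : ℝ) {z : GSpace n m}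
    (hz : coneBump p r A B H z = 0) (v : GSpace n m) :
    lineDeriv ℝ (coneBump p r A B H) z v = 0 := by
  refine IsLocalMin.deriv_eq_zero (Filter.Eventually.of_forall fun t => ?_)
  simp only [zero_smul, add_zero, hz]
  exact le_max_right _ _

/-- Cones at the length scale `T` in the first variable, with slopes adapted to the coefficients at
`|x₁| = T`, are trial functions. -/
theorem exists_isTrial_coneBump {c₁ c₂ : EuclideanSpace ℝ (Fin n) → ℝ}
    {C : GSpace n m → Matrix (Fin n ⊕ Fin m) (Fin n ⊕ Fin m) ℝ}
    (hδ₁ : 0 ≤ δ₁) (hδ₁' : 0 ≤ δ₁') (hδ₂ : 0 ≤ δ₂) (hδ₂' : 0 ≤ δ₂')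
    (hc₁ : IsDegCoeff δ₁ δ₁' c₁) (hc₂ : IsDegCoeff δ₂ δ₂' c₂)
    (hC : CoeffEquiv C (blockCoeff c₁ c₂)) :
    ∃ κ : ℝ, 0 < κ ∧ ∀ (p : GSpace n m) (T r B H : ℝ), 0 < T →
      (∀ a, ‖a - p.1‖ < r + T → ‖a‖ ≤ 2 * T) → 0 ≤ B → B ≤ κ / biPow T δ₂ δ₂' →
      H ≤ κ / biPow T δ₁ δ₁' * T → IsTrial C (coneBump p r (κ / biPow T δ₁ δ₁') B H) := by
  obtain ⟨κ₀, hκ₀, hψ⟩ := exists_isTrial_of_lipschitz hc₁ hc₂ hC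
  set P : ℝ := (2 : ℝ) ^ max δ₁ δ₁' with hP
  set Q : ℝ := (2 : ℝ) ^ max δ₂ δ₂' with hQ
  have hP0 : 0 < P := by positivity
  have hQ0 : 0 < Q := by positivity
  refine ⟨κ₀ / (P + Q), by positivity, fun p T r B H hT hp hB0 hB hH => ?_⟩
  set κ := κ₀ / (P + Q) with hκ
  have hκ0 : 0 < κ := by positivity
  have hp₁ := biPow_pos hT δ₁ δ₁'
  have hp₂ := biPow_pos hT δ₂ δ₂'
  have hA0 : 0 < κ / biPow T δ₁ δ₁' := by positivity
  refine hψ _ _ |H| (lipschitzWith_coneBump p r H hA0.le hB0) (fun z => ?_) fun z i => ?_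
  · rw [coneBump, abs_of_nonneg (le_max_right _ _)]
    refine max_le (le_trans ?_ (le_abs_self H)) (abs_nonneg _)
    have h1 : 0 ≤ κ / biPow T δ₁ δ₁' * max (‖z.1 - p.1‖ - r) 0 :=
      mul_nonneg hA0.le (le_max_right _ _)
    have h2 : 0 ≤ B * ‖z.2 - p.2‖ := by positivity
    linarith
  · rcases eq_or_ne (coneBump p r (κ / biPow T δ₁ δ₁') B H z) 0 with h0 | h0
    · rw [lineDeriv_coneBump_eq_zero _ _ _ _ _ h0]
      simpa using hκ₀.le
    -- at a point of the support `|z₁| ≤ 2 T`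
    have hz : ‖z.1‖ ≤ 2 * T := by
      refine hp _ ?_
      by_contra hcon
      refine h0 (max_eq_right ?_)
      have h1 : T ≤ max (‖z.1 - p.1‖ - r) 0 := le_max_of_le_left (by linarith)
      have h2 := mul_le_mul_of_nonneg_left h1 hA0.le
      have h3 : 0 ≤ B * ‖z.2 - p.2‖ := by positivity
      linarith
    have aux : ∀ α α' S : ℝ, 0 ≤ α → 0 ≤ α' → 0 ≤ S → S ≤ κ / biPow T α α' →
        (2 : ℝ) ^ max α α' ≤ P + Q → S * biPow ‖z.1‖ α α' ≤ κ₀ := by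
      intro α α' S hα hα' hS0 hS hle
      have hpT := biPow_pos hT α α'
      calc S * biPow ‖z.1‖ α α' ≤ κ / biPow T α α' * ((2 : ℝ) ^ max α α' * biPow T α α') := by
            refine mul_le_mul hS ?_ (biPow_nonneg (norm_nonneg _) _ _) (by positivity)
            exact (biPow_mono (norm_nonneg _) hz hα hα').trans
              (biPow_mul_le_of_one_le hT.le (by norm_num))
        _ = κ * (2 : ℝ) ^ max α α' := by field_simp
        _ ≤ κ * (P + Q) := by gcongr
        _ = κ₀ := by rw [hκ]; field_simp
    have hd := abs_lineDeriv_coneBump_le p r H hA0.le hB0 z i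
    rcases i with i | i
    · exact aux _ _ _ hδ₁ hδ₁' (abs_nonneg _) hd (by linarith)
    · exact aux _ _ _ hδ₂ hδ₂' (abs_nonneg _) (hd.trans hB) (by linarith)

/-- A cone that is maximal at `x` and vanishes at `y` separates the two points by its height. -/
theorem le_riemDist_of_coneBump {C : GSpace n m → Matrix (Fin n ⊕ Fin m) (Fin n ⊕ Fin m) ℝ}
    {p x y : GSpace n m} {r A B H : ℝ} (h : IsTrial C (coneBump p r A B H))
    (hx₁ : ‖x.1 - p.1‖ ≤ r) (hx₂ : x.2 = p.2)
    (hy : H ≤ A * max (‖y.1 - p.1‖ - r) 0 + B * ‖y.2 - p.2‖) :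
    ENNReal.ofReal H ≤ riemDist C x y := by
  refine le_trans (ENNReal.ofReal_le_ofReal ?_) (le_iSup₂ (f := fun (ψ : GSpace n m → ℝ)
    (_ : IsTrial C ψ) => ENNReal.ofReal (ψ x - ψ y)) _ h)
  have h1 : coneBump p r A B H y = 0 := max_eq_right (by linarith)
  have h2 : H ≤ coneBump p r A B H x := by
    refine le_max_of_le_left ?_
    rw [max_eq_right (by linarith), hx₂]
    simp
  linarith

/-- Each of the two terms of `D_δ` is bounded by the height of a cone separating the two points. -/
theorem exists_le_riemDist {c₁ c₂ : EuclideanSpace ℝ (Fin n) → ℝ}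
    {C : GSpace n m → Matrix (Fin n ⊕ Fin m) (Fin n ⊕ Fin m) ℝ}
    (hδ₁ : 0 ≤ δ₁ ∧ δ₁ < 1) (hδ₁' : 0 ≤ δ₁' ∧ δ₁' < 1) (hδ₂ : 0 ≤ δ₂) (hδ₂' : 0 ≤ δ₂')
    (hc₁ : IsDegCoeff δ₁ δ₁' c₁) (hc₂ : IsDegCoeff δ₂ δ₂' c₂)
    (hC : CoeffEquiv C (blockCoeff c₁ c₂)) :
    ∃ a : ℝ, 0 < a ∧ ∀ x y : GSpace n m,
      ENNReal.ofReal (a * grushinD δ₁ δ₁' δ₂ δ₂' x y) ≤ riemDist C x y := by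
  obtain ⟨κ, hκ, H⟩ := exists_isTrial_coneBump hδ₁.1 hδ₁'.1 hδ₂ hδ₂' hc₁ hc₂ hC
  have hρ : 0 < 1 + δ₂ - δ₁ := by linarith
  have hρ' : 0 < 1 + δ₂' - δ₁' := by linarith
  set Q : ℝ := (2 : ℝ) ^ max (1 + δ₂ - δ₁) (1 + δ₂' - δ₁') with hQ
  have hQ1 : 1 ≤ Q := Real.one_le_rpow (by norm_num) (le_max_of_le_left hρ.le)
  have hQ0 : 0 < Q := by positivity
  have hκQ : κ / Q ≤ κ := div_le_self hκ.le hQ1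
  suffices h : ∀ x y : GSpace n m, ‖y.1‖ ≤ ‖x.1‖ →
      ENNReal.ofReal (κ / (4 * Q) * grushinD δ₁ δ₁' δ₂ δ₂' x y) ≤ riemDist C x y by
    refine ⟨κ / (4 * Q), by positivity, fun x y => ?_⟩
    rcases le_total ‖y.1‖ ‖x.1‖ with hxy | hxy
    · exact h x y hxy
    · rw [grushinD_comm, riemDist_comm]
      exact h y x hxy
  rintro ⟨a, b⟩ ⟨a', b'⟩ hxy
  rw [grushinD, grushinDelta_eq hρ hρ']
  dsimp only at hxy ⊢
  set u := ‖b - b'‖ with hu_def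
  set R := biPow u (1 / (1 + δ₂ - δ₁)) (1 / (1 + δ₂' - δ₁')) with hR
  unfold grushinScale
  rw [← hR]
  have hs0 : 0 ≤ ‖a‖ + ‖a'‖ := by positivity
  -- cones centred at `x`, of height below `κ |x₁| / |x₁|^(δ₁, δ₁')`
  have hcentred : 0 < ‖a‖ → ∀ B h, 0 ≤ B → B ≤ κ / biPow ‖a‖ δ₂ δ₂' →
      h ≤ κ / biPow ‖a‖ δ₁ δ₁' * ‖a‖ → h ≤ κ / biPow ‖a‖ δ₁ δ₁' * ‖a - a'‖ + B * u →
      ENNReal.ofReal h ≤ riemDist C (a, b) (a', b') := by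
    intro ht B h hB0 hB hh hh'
    refine le_riemDist_of_coneBump (H (a, b) ‖a‖ 0 B h ht (fun w hw => ?_) hB0 hB hh)
      (by simp) rfl ?_
    · have := norm_sub_norm_le w a
      dsimp only at hw
      linarith
    · dsimp only
      rwa [sub_zero, max_eq_left (norm_nonneg _), norm_sub_rev a' a, norm_sub_rev b' b]
  have hfst : ENNReal.ofReal (κ / (2 * Q) * (‖a - a'‖ / biPow (‖a‖ + ‖a'‖) δ₁ δ₁')) ≤
      riemDist C (a, b) (a', b') := by
    rcases eq_or_ne a 0 with rfl | ha
    · have : a' = 0 := by simpa using hxy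
      simp [this]
    have ht : 0 < ‖a‖ := norm_pos_iff.2 ha
    have hpt := biPow_pos ht δ₁ δ₁'
    have hmono : biPow ‖a‖ δ₁ δ₁' ≤ biPow (‖a‖ + ‖a'‖) δ₁ δ₁' :=
      biPow_mono ht.le (by linarith [norm_nonneg a']) hδ₁.1 hδ₁'.1
    have htri : ‖a - a'‖ / 2 ≤ ‖a‖ := by linarith [norm_sub_le a a']
    have h1 := hcentred ht 0 (κ / biPow ‖a‖ δ₁ δ₁' * (‖a - a'‖ / 2)) le_rfl
      (div_nonneg hκ.le (biPow_nonneg ht.le _ _)) (by gcongr) (by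
        rw [zero_mul, add_zero]; gcongr; linarith [norm_nonneg (a - a')])
    refine (ENNReal.ofReal_le_ofReal ?_).trans h1
    calc κ / (2 * Q) * (‖a - a'‖ / biPow (‖a‖ + ‖a'‖) δ₁ δ₁')
        ≤ κ / (2 * 1) * (‖a - a'‖ / biPow ‖a‖ δ₁ δ₁') := by
          have := hpt.trans_le hmono
          gcongr
      _ = κ / biPow ‖a‖ δ₁ δ₁' * (‖a - a'‖ / 2) := by ring
  have hsnd : ENNReal.ofReal (κ / Q * (u / biPow (max (‖a‖ + ‖a'‖) R) δ₂ δ₂')) ≤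
      riemDist C (a, b) (a', b') := by
    rcases (norm_nonneg (b - b')).eq_or_lt with h0 | hu
    · rw [hu_def, ← h0]; simp
    rw [← hu_def] at hu
    have hR0 : 0 < R := biPow_pos hu _ _
    have huR : u = biPow R (1 + δ₂ - δ₁) (1 + δ₂' - δ₁') := by
      rw [hR, biPow_biPow_inv hu.le hρ hρ']
    have hratio : ∀ T, 0 < T → biPow T (1 + δ₂ - δ₁) (1 + δ₂' - δ₁') / biPow T δ₂ δ₂' =
        T / biPow T δ₁ δ₁' := by
      intro T hT
      rw [biPow_div_biPow hT, show T / biPow T δ₁ δ₁' = biPow T 1 1 / biPow T δ₁ δ₁' by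
        rw [biPow_one_one], biPow_div_biPow hT]
      congr 1 <;> ring
    rcases le_total R (‖a‖ + ‖a'‖) with hRs | hRs
    · rw [max_eq_left hRs]
      have ht : 0 < ‖a‖ := by linarith
      have hp₁ := biPow_pos ht δ₁ δ₁'
      have hp₂ := biPow_pos ht δ₂ δ₂'
      have hmono : biPow ‖a‖ δ₂ δ₂' ≤ biPow (‖a‖ + ‖a'‖) δ₂ δ₂' :=
        biPow_mono ht.le (by linarith [norm_nonneg a']) hδ₂ hδ₂'
      have hule : u ≤ Q * biPow ‖a‖ (1 + δ₂ - δ₁) (1 + δ₂' - δ₁') := by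
        rw [huR]
        exact (biPow_mono hR0.le (by linarith : R ≤ 2 * ‖a‖) hρ.le hρ'.le).trans
          (biPow_mul_le_of_one_le ht.le (by norm_num))
      have hA : 0 ≤ κ / biPow ‖a‖ δ₁ δ₁' * ‖a - a'‖ := by positivity
      have hle : κ / Q * (u / biPow ‖a‖ δ₂ δ₂') ≤ κ / biPow ‖a‖ δ₁ δ₁' * ‖a‖ := by
        calc κ / Q * (u / biPow ‖a‖ δ₂ δ₂')
            ≤ κ / Q * (Q * biPow ‖a‖ (1 + δ₂ - δ₁) (1 + δ₂' - δ₁') / biPow ‖a‖ δ₂ δ₂') := by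
              gcongr
          _ = κ * (biPow ‖a‖ (1 + δ₂ - δ₁) (1 + δ₂' - δ₁') / biPow ‖a‖ δ₂ δ₂') := by
              field_simp
          _ = κ / biPow ‖a‖ δ₁ δ₁' * ‖a‖ := by rw [hratio _ ht]; ring
      refine hcentred ht (κ / biPow ‖a‖ δ₂ δ₂') _ (by positivity) le_rfl (le_trans ?_ hle) ?_
      · have := hp₂.trans_le hmono
        gcongr
      · have : κ / Q * (u / biPow (‖a‖ + ‖a'‖) δ₂ δ₂') ≤ κ * (u / biPow ‖a‖ δ₂ δ₂') := by
          have := hp₂.trans_le hmono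
          gcongr
        have e : κ * (u / biPow ‖a‖ δ₂ δ₂') = κ / biPow ‖a‖ δ₂ δ₂' * u := by ring
        linarith
    · rw [max_eq_right hRs]
      have hp₁ := biPow_pos hR0 δ₁ δ₁'
      have hp₂ := biPow_pos hR0 δ₂ δ₂'
      have hle : κ / Q * (u / biPow R δ₂ δ₂') ≤ κ / biPow R δ₂ δ₂' * u :=
        (mul_le_mul_of_nonneg_right hκQ (by positivity)).trans_eq (by ring)
      have heq : κ / biPow R δ₂ δ₂' * u = κ / biPow R δ₁ δ₁' * R := by
        calc κ / biPow R δ₂ δ₂' * u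
            = κ * (biPow R (1 + δ₂ - δ₁) (1 + δ₂' - δ₁') / biPow R δ₂ δ₂') := by
              rw [← huR]; ring
          _ = κ / biPow R δ₁ δ₁' * R := by rw [hratio _ hR0]; ring
      refine (ENNReal.ofReal_le_ofReal hle).trans ?_
      refine le_riemDist_of_coneBump (H (0, b) R R (κ / biPow R δ₂ δ₂') (κ / biPow R δ₂ δ₂' * u)
        hR0 (fun w hw => ?_) (by positivity) le_rfl heq.le) ?_ rfl ?_
      · rw [sub_zero] at hw; linarith
      · dsimp only; rw [sub_zero]; linarith [norm_nonneg a']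
      · dsimp only
        rw [norm_sub_rev b' b, ← hu_def]
        have : 0 ≤ κ / biPow R δ₁ δ₁' * max (‖a' - 0‖ - R) 0 :=
          mul_nonneg (by positivity) (le_max_right _ _)
        linarith
  set E₁ := ‖a - a'‖ / biPow (‖a‖ + ‖a'‖) δ₁ δ₁' with hE₁
  set E₂ := u / biPow (max (‖a‖ + ‖a'‖) R) δ₂ δ₂' with hE₂
  have hc : 0 < κ / (4 * Q) := by positivity
  rcases le_total E₁ E₂ with h | h
  · refine (ENNReal.ofReal_le_ofReal ?_).trans hsnd
    have := mul_le_mul_of_nonneg_left h hc.le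
    have hE₂0 : 0 ≤ E₂ :=
      div_nonneg (norm_nonneg _) (biPow_nonneg (hs0.trans (le_max_left _ _)) _ _)
    have := mul_nonneg hc.le hE₂0
    have e : κ / Q * E₂ = 4 * (κ / (4 * Q) * E₂) := by field_simp
    linarith
  · refine (ENNReal.ofReal_le_ofReal ?_).trans hfst
    have := mul_le_mul_of_nonneg_left h hc.le
    have e : κ / (2 * Q) * E₁ = 2 * (κ / (4 * Q) * E₁) := by field_simp; ring
    linarith

end LowerBound

/-! ### The volume of the balls -/

section Volume

variable {n m : ℕ} {δ₁ δ₁' δ₂ δ₂' : ℝ}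

/-- The length scale `max |x₁| (r^(1/(1 - δ₁), 1/(1 - δ₁')))` of the first variable in the ball of
radius `r` about `x`, as a function of `t = |x₁|`. -/
noncomputable def ballScale (δ₁ δ₁' t r : ℝ) : ℝ := max t (biPow r (1 / (1 - δ₁)) (1 / (1 - δ₁')))

/-- The product of Euclidean balls about `x` that is comparable to the ball of radius `r`, with its
two radii multiplied by `k`. -/
def ballBox (δ₁ δ₁' δ₂ δ₂' k : ℝ) (x : GSpace n m) (r : ℝ) : Set (GSpace n m) :=
  Metric.closedBall x.1 (k * (r * biPow (ballScale δ₁ δ₁' ‖x.1‖ r) δ₁ δ₁')) ×ˢ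
    Metric.closedBall x.2 (k * (r * biPow (ballScale δ₁ δ₁' ‖x.1‖ r) δ₂ δ₂'))

theorem mem_ballBox {k r : ℝ} {x y : GSpace n m} :
    y ∈ ballBox δ₁ δ₁' δ₂ δ₂' k x r ↔
      ‖x.1 - y.1‖ ≤ k * (r * biPow (ballScale δ₁ δ₁' ‖x.1‖ r) δ₁ δ₁') ∧
        ‖x.2 - y.2‖ ≤ k * (r * biPow (ballScale δ₁ δ₁' ‖x.1‖ r) δ₂ δ₂') := by
  simp only [ballBox, Set.mem_prod, Metric.mem_closedBall, dist_comm y.1, dist_comm y.2,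
    dist_eq_norm]

/-- Sublevel sets of `D_δ` lie in boxes: if `D_δ(x; y) = O(r)` then `|y₁|` and the scale of the
displacement `x₂ - y₂` are `O(M)`, with `M` the scale of the ball. -/
theorem exists_mem_ballBox (hδ₁ : 0 ≤ δ₁ ∧ δ₁ < 1) (hδ₁' : 0 ≤ δ₁' ∧ δ₁' < 1) (hδ₂ : 0 ≤ δ₂)
    (hδ₂' : 0 ≤ δ₂') (K : ℝ) :
    ∃ k : ℝ, 0 < k ∧ ∀ (x y : GSpace n m) (r : ℝ), 0 < r →
      grushinD δ₁ δ₁' δ₂ δ₂' x y ≤ K * r → y ∈ ballBox δ₁ δ₁' δ₂ δ₂' k x r := by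
  wlog hK : 1 ≤ K generalizing K
  · obtain ⟨k, hk, H⟩ := this 1 le_rfl
    exact ⟨k, hk, fun x y r hr h => H x y r hr (h.trans (by
      have := not_le.1 hK; gcongr))⟩
  have h1 : 0 < 1 - δ₁ := by linarith
  have h1' : 0 < 1 - δ₁' := by linarith
  have hρ : 0 < 1 + δ₂ - δ₁ := by linarith
  have hρ' : 0 < 1 + δ₂' - δ₁' := by linarith
  set L : ℝ := (2 * K) ^ max (1 / (1 - δ₁)) (1 / (1 - δ₁')) with hL
  have hL0 : 0 < L := by positivity
  set P : ℝ := (4 + L) ^ max δ₁ δ₁' with hP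
  set Q : ℝ := (4 + L) ^ max δ₂ δ₂' with hQ
  have hP0 : 0 < P := by positivity
  have hQ0 : 0 < Q := by positivity
  refine ⟨K * (P + Q), by positivity, fun x y r hr hD => ?_⟩
  rw [grushinD, grushinDelta_eq hρ hρ'] at hD
  rw [mem_ballBox]
  set M := ballScale δ₁ δ₁' ‖x.1‖ r with hM
  have hrM : r ≤ biPow M (1 - δ₁) (1 - δ₁') := by
    rw [le_biPow_iff (hM ▸ (norm_nonneg x.1).trans (le_max_left _ _)) hr.le h1 h1']
    exact le_max_right _ _
  have hM0 : 0 < M := lt_max_of_lt_right (biPow_pos hr _ _)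
  have hxM : ‖x.1‖ ≤ M := le_max_left _ _
  set s := ‖x.1‖ + ‖y.1‖ with hs
  have hs0 : 0 ≤ s := by positivity
  set v := ‖x.1 - y.1‖ with hv
  set u := ‖x.2 - y.2‖ with hu_def
  have hv0 : 0 ≤ v := norm_nonneg _
  set S := grushinScale (1 + δ₂ - δ₁) (1 + δ₂' - δ₁') s u with hS
  have hS0 : 0 ≤ S := hs0.trans (le_max_left _ _)
  have hE₁0 : 0 ≤ v / biPow s δ₁ δ₁' := div_nonneg (norm_nonneg _) (biPow_nonneg hs0 _ _)
  have hE₂0 : 0 ≤ u / biPow S δ₂ δ₂' := div_nonneg (norm_nonneg _) (biPow_nonneg hS0 _ _)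
  have hE₁ : v / biPow s δ₁ δ₁' ≤ K * r := by linarith
  have hE₂ : u / biPow S δ₂ δ₂' ≤ K * r := by linarith
  have hKr : K * r ≤ K * biPow M (1 - δ₁) (1 - δ₁') := by gcongr
  -- lengths whose `(1 - δ₁, 1 - δ₁')` power is `O(r)` are `O(M)`
  have hlen : ∀ l, 0 ≤ l → biPow l (1 - δ₁) (1 - δ₁') ≤ 2 * (K * r) → l ≤ (4 + L) * M := by
    intro l hl hle
    have := le_mul_of_biPow_le (K := 2 * K) hl hM0.le (by linarith) h1 h1' (by linarith)
    refine this.trans ?_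
    gcongr
    linarith
  have hsM : s ≤ (4 + L) * M := by
    by_cases h4 : s ≤ 4 * M
    · refine h4.trans ?_
      gcongr
      linarith
    · have hs' : 0 < s := by linarith
      have hvs : s / 2 ≤ v := by
        have := norm_sub_norm_le y.1 x.1
        rw [norm_sub_rev] at this
        linarith
      refine hlen s hs0 ?_
      rw [← div_biPow_eq hs']
      have hps := biPow_pos hs' δ₁ δ₁'
      have : s / 2 / biPow s δ₁ δ₁' ≤ v / biPow s δ₁ δ₁' := by gcongr
      rw [div_right_comm] at this
      linarith
  have hSM : u = 0 ∨ (0 < S ∧ S ≤ (4 + L) * M) := by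
    rcases (norm_nonneg (x.2 - y.2)).eq_or_lt with h | h
    · exact Or.inl h.symm
    refine Or.inr ⟨grushinScale_pos (Or.inr h), max_le hsM ?_⟩
    set R := biPow u (1 / (1 + δ₂ - δ₁)) (1 / (1 + δ₂' - δ₁')) with hR
    have hR0 : 0 < R := biPow_pos h _ _
    rcases le_total R s with hRs | hRs
    · exact hRs.trans hsM
    · refine hlen R hR0.le ?_
      rw [hR, ← div_biPow_biPow_inv h hρ hρ', ← hR]
      have : S = R := max_eq_right hRs
      rw [this] at hE₂
      linarith [mul_pos (zero_lt_one.trans_le hK) hr]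
  have hfac : ∀ α α' l w : ℝ, 0 ≤ α → 0 ≤ α' → 0 < l → l ≤ (4 + L) * M →
      w / biPow l α α' ≤ K * r → (4 + L) ^ max α α' ≤ P + Q →
      w ≤ K * (P + Q) * (r * biPow M α α') := by
    intro α α' l w hα hα' hl hle hw hPQ
    have hMp := biPow_pos hM0 α α'
    calc w ≤ K * r * biPow l α α' := (div_le_iff₀ (biPow_pos hl _ _)).1 hw
      _ ≤ K * r * ((4 + L) ^ max α α' * biPow M α α') := by
          gcongr
          exact (biPow_mono hl.le hle hα hα').trans
            (biPow_mul_le_of_one_le hM0.le (by linarith))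
      _ ≤ K * r * ((P + Q) * biPow M α α') := by gcongr
      _ = _ := by ring
  constructor
  · rcases hs0.eq_or_lt with h | h
    · have : v ≤ 0 := (norm_sub_le _ _).trans h.symm.le
      exact this.trans (mul_nonneg (by positivity)
        (mul_nonneg hr.le (biPow_nonneg hM0.le _ _)))
    · exact hfac _ _ s v hδ₁.1 hδ₁'.1 h hsM hE₁ (by linarith)
  · rcases hSM with h | ⟨h, h'⟩
    · rw [h]
      exact mul_nonneg (by positivity) (mul_nonneg hr.le (biPow_nonneg hM0.le _ _))
    · exact hfac _ _ S u hδ₂ hδ₂' h h' hE₂ (by linarith)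

/-- Small boxes lie in sublevel sets of `D_δ`. For `M = |x₁|` both terms of `D_δ` are estimated with
the weights at `|x₁|`, otherwise with the weights at the size of the displacements themselves. -/
theorem exists_ballBox_imp_lt (hδ₁ : 0 ≤ δ₁ ∧ δ₁ < 1) (hδ₁' : 0 ≤ δ₁' ∧ δ₁' < 1) (hδ₂ : 0 ≤ δ₂)
    (hδ₂' : 0 ≤ δ₂') {η : ℝ} (hη : 0 < η) :
    ∃ ε : ℝ, 0 < ε ∧ ∀ (x y : GSpace n m) (r : ℝ), 0 < r →
      y ∈ ballBox δ₁ δ₁' δ₂ δ₂' ε x r → grushinD δ₁ δ₁' δ₂ δ₂' x y < η * r := by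
  have h1 : 0 < 1 - δ₁ := by linarith
  have h1' : 0 < 1 - δ₁' := by linarith
  have hρ : 0 < 1 + δ₂ - δ₁ := by linarith
  have hρ' : 0 < 1 + δ₂' - δ₁' := by linarith
  set σ := min (1 - δ₁) (1 - δ₁') with hσ
  set τ := min (1 / (1 + δ₂ - δ₁)) (1 / (1 + δ₂' - δ₁')) with hτ
  have hσ0 : 0 < σ := lt_min h1 h1'
  have hτ0 : 0 < τ := lt_min (by positivity) (by positivity)
  have hsmall : ∀ e : ℝ, 0 < e → ∀ᶠ t in nhdsWithin (0 : ℝ) (Set.Ioi 0), t ^ e < η / 2 := by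
    intro e he
    have := (Real.continuousAt_rpow_const 0 e (Or.inr he.le)).tendsto
    rw [Real.zero_rpow he.ne'] at this
    exact (this.mono_left nhdsWithin_le_nhds).eventually_lt_const (by positivity)
  obtain ⟨ε, ⟨⟨⟨hε1, hεσ⟩, hετ⟩, hε0⟩, hεle⟩ :=
    ((((hsmall 1 one_pos).and (hsmall σ hσ0)).and (hsmall (τ * σ) (by positivity))).and
      self_mem_nhdsWithin).and (Ioo_mem_nhdsGT one_pos) |>.exists
  rw [Real.rpow_one] at hε1
  replace hεle : ε ≤ 1 := hεle.2.le
  refine ⟨ε, hε0, fun x y r hr hy => ?_⟩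
  rw [mem_ballBox] at hy
  rw [grushinD, grushinDelta_eq hρ hρ']
  set s := ‖x.1‖ + ‖y.1‖ with hs
  have hs0 : 0 ≤ s := by positivity
  set v := ‖x.1 - y.1‖ with hv
  set u := ‖x.2 - y.2‖ with hu_def
  have hv0 : 0 ≤ v := norm_nonneg _
  have hu0 : 0 ≤ u := norm_nonneg _
  suffices h : v / biPow s δ₁ δ₁' < η / 2 * r ∧
      u / biPow (grushinScale (1 + δ₂ - δ₁) (1 + δ₂' - δ₁') s u) δ₂ δ₂' < η / 2 * r by
    linarith [h.1, h.2]
  set T := biPow r (1 / (1 - δ₁)) (1 / (1 - δ₁')) with hT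
  have hT0 : 0 < T := biPow_pos hr _ _
  rcases le_total T ‖x.1‖ with hTx | hTx
  · have hM : ballScale δ₁ δ₁' ‖x.1‖ r = ‖x.1‖ := max_eq_left hTx
    rw [hM] at hy
    have ht : 0 < ‖x.1‖ := hT0.trans_le hTx
    have hts : ‖x.1‖ ≤ s := by linarith [norm_nonneg y.1]
    have haux : ∀ α α' l w : ℝ, 0 ≤ α → 0 ≤ α' → ‖x.1‖ ≤ l → 0 ≤ w →
        w ≤ ε * (r * biPow ‖x.1‖ α α') → w / biPow l α α' < η / 2 * r := by
      intro α α' l w hα hα' hl hw0 hw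
      have hp := biPow_pos ht α α'
      calc w / biPow l α α' ≤ w / biPow ‖x.1‖ α α' := by
            gcongr; exact biPow_mono ht.le hl hα hα'
        _ ≤ ε * (r * biPow ‖x.1‖ α α') / biPow ‖x.1‖ α α' := by gcongr
        _ = ε * r := by field_simp
        _ < η / 2 * r := by gcongr
    exact ⟨haux _ _ _ _ hδ₁.1 hδ₁'.1 hts hv0 hy.1,
      haux _ _ _ _ hδ₂ hδ₂' (hts.trans (le_max_left _ _)) hu0 hy.2⟩
  · have hM : ballScale δ₁ δ₁' ‖x.1‖ r = T := max_eq_right hTx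
    rw [hM] at hy
    have hrT : r = biPow T (1 - δ₁) (1 - δ₁') := by rw [hT, biPow_biPow_inv hr.le h1 h1']
    have hzero : (0 : ℝ) < η / 2 * r := by positivity
    -- a length `l` at most `e T` has `(1 - δ₁, 1 - δ₁')` power at most `e ^ σ r`
    have hlen : ∀ e l : ℝ, 0 < e → e ≤ 1 → 0 ≤ l → l ≤ e * T → e ^ σ < η / 2 →
        biPow l (1 - δ₁) (1 - δ₁') < η / 2 * r := by
      intro e l he he1 hl hle hη
      calc biPow l (1 - δ₁) (1 - δ₁') ≤ biPow (e * T) (1 - δ₁) (1 - δ₁') :=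
            biPow_mono hl hle h1.le h1'.le
        _ ≤ e ^ σ * biPow T (1 - δ₁) (1 - δ₁') := biPow_mul_le_of_le_one hT0 he he1
        _ < η / 2 * r := by rw [← hrT]; gcongr
    have hrT₁ : r * biPow T δ₁ δ₁' = T := by
      nth_rw 1 [hrT]
      rw [biPow_mul_biPow hT0, sub_add_cancel, sub_add_cancel, biPow_one_one]
    have hrT₂ : r * biPow T δ₂ δ₂' = biPow T (1 + δ₂ - δ₁) (1 + δ₂' - δ₁') := by
      nth_rw 1 [hrT]
      rw [biPow_mul_biPow hT0]
      congr 1 <;> ring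
    rw [hrT₁, hrT₂] at hy
    constructor
    · rcases hv0.eq_or_lt with h | h
      · rw [← h, zero_div]; exact hzero
      · have hp := biPow_pos h δ₁ δ₁'
        calc v / biPow s δ₁ δ₁' ≤ v / biPow v δ₁ δ₁' := by
              gcongr; exact biPow_mono hv0 (norm_sub_le _ _) hδ₁.1 hδ₁'.1
          _ = biPow v (1 - δ₁) (1 - δ₁') := div_biPow_eq h _ _
          _ < η / 2 * r := hlen ε v hε0 hεle hv0 hy.1 hεσ
    · rcases hu0.eq_or_lt with h | h
      · rw [← h, zero_div]; exact hzero
      · set R := biPow u (1 / (1 + δ₂ - δ₁)) (1 / (1 + δ₂' - δ₁')) with hR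
        have hR0 : 0 < R := biPow_pos h _ _
        have hp := biPow_pos hR0 δ₂ δ₂'
        have hRle : R ≤ ε ^ τ * T := by
          calc R ≤ biPow (ε * biPow T (1 + δ₂ - δ₁) (1 + δ₂' - δ₁'))
                (1 / (1 + δ₂ - δ₁)) (1 / (1 + δ₂' - δ₁')) :=
                biPow_mono hu0 hy.2 (by positivity) (by positivity)
            _ ≤ ε ^ τ * biPow (biPow T (1 + δ₂ - δ₁) (1 + δ₂' - δ₁'))
                (1 / (1 + δ₂ - δ₁)) (1 / (1 + δ₂' - δ₁')) :=
                biPow_mul_le_of_le_one (biPow_pos hT0 _ _) hε0 hεle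
            _ = ε ^ τ * T := by rw [biPow_inv_biPow hT0.le hρ hρ']
        calc u / biPow (grushinScale (1 + δ₂ - δ₁) (1 + δ₂' - δ₁') s u) δ₂ δ₂'
            ≤ u / biPow R δ₂ δ₂' := by
              gcongr; exact biPow_mono hR0.le (le_max_right _ _) hδ₂ hδ₂'
          _ = biPow R (1 - δ₁) (1 - δ₁') := div_biPow_biPow_inv h hρ hρ'
          _ < η / 2 * r := hlen (ε ^ τ) R (by positivity)
              (Real.rpow_le_one hε0.le hεle hτ0.le) hR0.le hRle
              (by rwa [← Real.rpow_mul hε0.le])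

/-- The common form `r^(n+m) M^(β, β')` of the two volume formulas, `M` being the scale of the
ball. -/
theorem volume_ballBox (n m : ℕ) (δ₁ δ₁' δ₂ δ₂' : ℝ) :
    ∃ V : ℝ, 0 < V ∧ ∀ (k : ℝ) (x : GSpace n m) (r : ℝ), 0 < k → 0 < r →
      volume (ballBox δ₁ δ₁' δ₂ δ₂' k x r) = ENNReal.ofReal (V * k ^ (n + m) * (r ^ (n + m) *
        biPow (ballScale δ₁ δ₁' ‖x.1‖ r) (n * δ₁ + m * δ₂) (n * δ₁' + m * δ₂'))) := by
  have hball : ∀ k : ℕ, ∃ V : ℝ, 0 < V ∧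
      volume (Metric.ball (0 : EuclideanSpace ℝ (Fin k)) 1) = ENNReal.ofReal V := fun k =>
    ⟨_, ENNReal.toReal_pos (Metric.measure_ball_pos _ _ one_pos).ne' measure_ball_lt_top.ne,
      (ENNReal.ofReal_toReal measure_ball_lt_top.ne).symm⟩
  obtain ⟨V₁, hV₁, e₁⟩ := hball n
  obtain ⟨V₂, hV₂, e₂⟩ := hball m
  refine ⟨V₁ * V₂, by positivity, fun k x r hk hr => ?_⟩
  have hM : 0 < ballScale δ₁ δ₁' ‖x.1‖ r := lt_max_of_lt_right (biPow_pos hr _ _)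
  unfold ballBox
  set M := ballScale δ₁ δ₁' ‖x.1‖ r
  have hp₁ := biPow_pos hM δ₁ δ₁'
  have hp₂ := biPow_pos hM δ₂ δ₂'
  rw [Measure.volume_eq_prod, Measure.prod_prod, Measure.addHaar_closedBall _ _ (by positivity),
    Measure.addHaar_closedBall _ _ (by positivity), e₁, e₂, finrank_euclideanSpace_fin,
    finrank_euclideanSpace_fin, ← ENNReal.ofReal_mul (by positivity),
    ← ENNReal.ofReal_mul (by positivity), ← ENNReal.ofReal_mul (by positivity),
    ← biPow_mul_biPow hM, ← biPow_pow hM.le, ← biPow_pow hM.le]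
  congr 1
  ring

/-- For large radii the common volume formula is the power of `r` given by the dimension. -/
theorem pow_mul_biPow_ballScale {t r : ℝ} (hr : 0 < r) (hδ₁ : δ₁ < 1) (hδ₁' : δ₁' < 1)
    (h : t ≤ biPow r (1 / (1 - δ₁)) (1 / (1 - δ₁'))) :
    r ^ (n + m) * biPow (ballScale δ₁ δ₁' t r) (n * δ₁ + m * δ₂) (n * δ₁' + m * δ₂') =
      biPow r (grushinDim n m δ₁ δ₂) (grushinDim n m δ₁' δ₂') := by
  have h1 : 0 < 1 - δ₁ := by linarith
  have h1' : 0 < 1 - δ₁' := by linarith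
  rw [ballScale, max_eq_right h, biPow_biPow hr.le (by positivity) (by positivity)]
  nth_rw 1 [← biPow_one_one r]
  rw [biPow_pow hr.le, biPow_mul_biPow hr]
  unfold grushinDim
  congr 1
  · field_simp; push_cast; ring
  · field_simp; push_cast; ring

/-- The volume estimates hold for every matrix field whose distance is comparable to `D_δ`. -/
theorem ballVolumeEstimates_of_riemDist
    {C : GSpace n m → Matrix (Fin n ⊕ Fin m) (Fin n ⊕ Fin m) ℝ}
    (hδ₁ : 0 ≤ δ₁ ∧ δ₁ < 1) (hδ₁' : 0 ≤ δ₁' ∧ δ₁' < 1) (hδ₂ : 0 ≤ δ₂) (hδ₂' : 0 ≤ δ₂')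
    {a a' : ℝ} (ha : 0 < a) (ha' : 0 < a')
    (hlow : ∀ x y, ENNReal.ofReal (a * grushinD δ₁ δ₁' δ₂ δ₂' x y) ≤ riemDist C x y)
    (hup : ∀ x y, riemDist C x y ≤ ENNReal.ofReal (a' * grushinD δ₁ δ₁' δ₂ δ₂' x y)) :
    BallVolumeEstimates δ₁ δ₁' δ₂ δ₂' C := by
  have h1 : 0 < 1 - δ₁ := by linarith
  have h1' : 0 < 1 - δ₁' := by linarith
  obtain ⟨k, hk, Hk⟩ := exists_mem_ballBox (n := n) (m := m) hδ₁ hδ₁' hδ₂ hδ₂' (1 / a)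
  obtain ⟨ε, hε, Hε⟩ := exists_ballBox_imp_lt (n := n) (m := m) hδ₁ hδ₁' hδ₂ hδ₂'
    (η := 1 / a') (by positivity)
  obtain ⟨V, hV, HV⟩ := volume_ballBox n m δ₁ δ₁' δ₂ δ₂'
  have hsub₁ : ∀ (x : GSpace n m) r, 0 < r →
      ballBox δ₁ δ₁' δ₂ δ₂' ε x r ⊆ riemBall C x r := by
    intro x r hr y hy
    refine (hup x y).trans_lt ((ENNReal.ofReal_lt_ofReal_iff hr).2 ?_)
    calc a' * grushinD δ₁ δ₁' δ₂ δ₂' x y < a' * (1 / a' * r) := by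
          gcongr; exact Hε x y r hr hy
      _ = r := by field_simp
  have hsub₂ : ∀ (x : GSpace n m) r, 0 < r →
      riemBall C x r ⊆ ballBox δ₁ δ₁' δ₂ δ₂' k x r := by
    intro x r hr y hy
    have h : a * grushinD δ₁ δ₁' δ₂ δ₂' x y < r :=
      (ENNReal.ofReal_lt_ofReal_iff hr).1 ((hlow x y).trans_lt hy)
    refine Hk x y r hr ?_
    rw [one_div_mul_eq_div, le_div_iff₀ ha]
    linarith
  refine ⟨V * ε ^ (n + m), V * k ^ (n + m), by positivity, by positivity, fun x r hr => ?_⟩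
  have hlow' := measure_mono (μ := volume) (hsub₁ x r hr)
  have hup' := measure_mono (μ := volume) (hsub₂ x r hr)
  rw [HV _ _ _ hε hr] at hlow'
  rw [HV _ _ _ hk hr] at hup'
  constructor
  · intro h
    rw [pow_mul_biPow_ballScale hr hδ₁.2 hδ₁'.2
      ((biPow_le_iff (norm_nonneg _) hr.le h1 h1').1 h)] at hlow' hup'
    exact ⟨hlow', hup'⟩
  · intro h
    rw [show ballScale δ₁ δ₁' ‖x.1‖ r = ‖x.1‖ from
      max_eq_left ((le_biPow_iff (norm_nonneg _) hr.le h1 h1').1 h)] at hlow' hup'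
    exact ⟨hlow', hup'⟩

end Volume

theorem CoeffEquiv.refl {n m : ℕ} (C : GSpace n m → Matrix (Fin n ⊕ Fin m) (Fin n ⊕ Fin m) ℝ) :
    CoeffEquiv C C :=
  ⟨1, 1, one_pos, one_pos, Filter.Eventually.of_forall fun x => by
    simp [Matrix.PosSemidef.zero]⟩

theorem proposition5p1 (n m : ℕ) (hn : 1 ≤ n) (δ₁ δ₁' δ₂ δ₂' : ℝ)
    (hδ₁ : 0 ≤ δ₁ ∧ δ₁ < 1) (hδ₁' : 0 ≤ δ₁' ∧ δ₁' < 1) (hδ₂ : 0 ≤ δ₂) (hδ₂' : 0 ≤ δ₂')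
    (c₁ c₂ : EuclideanSpace ℝ (Fin n) → ℝ)
    (hc₁ : IsDegCoeff δ₁ δ₁' c₁) (hc₂ : IsDegCoeff δ₂ δ₂' c₂)
    (C : GSpace n m → Matrix (Fin n ⊕ Fin m) (Fin n ⊕ Fin m) ℝ)
    (hCmeas : ∀ i j, Measurable fun x => C x i j)
    (hC : CoeffEquiv C (blockCoeff c₁ c₂)) :
    (∃ a a' : ℝ, 0 < a ∧ 0 < a' ∧ ∀ x y : GSpace n m,
      ENNReal.ofReal (a * grushinD δ₁ δ₁' δ₂ δ₂' x y) ≤ riemDist (blockCoeff c₁ c₂) x y ∧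
      riemDist (blockCoeff c₁ c₂) x y ≤ ENNReal.ofReal (a' * grushinD δ₁ δ₁' δ₂ δ₂' x y)) ∧
    BallVolumeEstimates δ₁ δ₁' δ₂ δ₂' (blockCoeff (m := m) c₁ c₂) ∧
    BallVolumeEstimates δ₁ δ₁' δ₂ δ₂' C := by
  obtain ⟨a, ha, hlow⟩ := exists_le_riemDist hδ₁ hδ₁' hδ₂ hδ₂' hc₁ hc₂
    (CoeffEquiv.refl (blockCoeff (m := m) c₁ c₂))
  obtain ⟨a', ha', hup⟩ := exists_riemDist_le hn hδ₁ hδ₁' hδ₂ hδ₂' hc₁ hc₂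
    (CoeffEquiv.refl (blockCoeff (m := m) c₁ c₂))
  obtain ⟨b, hb, hlow'⟩ := exists_le_riemDist hδ₁ hδ₁' hδ₂ hδ₂' hc₁ hc₂ hC
  obtain ⟨b', hb', hup'⟩ := exists_riemDist_le hn hδ₁ hδ₁' hδ₂ hδ₂' hc₁ hc₂ hC
  exact ⟨⟨a, a', ha, ha', fun x y => ⟨hlow x y, hup x y⟩⟩,
    ballVolumeEstimates_of_riemDist hδ₁ hδ₁' hδ₂ hδ₂' ha ha' hlow hup,
    ballVolumeEstimates_of_riemDist hδ₁ hδ₁' hδ₂ hδ₂' hb hb' hlow' hup'⟩
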